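/- **Conventions.** Let $k$ be a field. A finite directed graph $E=(E^0,E^1,s,r)$ has finite vertex and edge sets $E^0,E^1$ and source and range maps $s,r:E^1\to E^0$; a sink is a vertex that is the source of no edge. The adjacency matrix of $E$ is the $E^0\times E^0$ matrix whose $(v,w)$ entry is the number of edges from $v$ to $w$. Two square matrices $A,B$ over $\mathbb Z_{\ge 0}$ (of possibly different sizes) are elementary strong shift equivalent if $A=RS$ and $B=SR$ for some rectangular matrices $R,S$ over $\mathbb Z_{\ge 0}$; strong shift equivalence is the transitive closure of this relation. $kE^0$ is the $k$-algebra with basis $E^0$ and product $vw=\delta_{v,w}v$, and $kE^1$ is the $kE^0$–$kE^0$-bimodule with basis $E^1$ and $v\cdot e=\delta_{v,s(e)}e$, $e\cdot w=\delta_{r(e),w}e$. Bimodules over $k$-algebras are those on which $k$ acts in the same way from both sides. $\alpha_{X,Y,Z}:(X\otimes Y)\otimes Z\to X\otimes(Y\otimes Z)$ is the associativity isomorphism. For $n\ge 1$ let $$\nu_n^E: kE^1\otimes_{kE^0}(kE^1)^{\otimes n}\to (kE^1)^{\otimes n}\otimes_{kE^0}kE^1,\quad x\otimes(y_1\otimes\cdots\otimes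 y_n)\mapsto(x\otimes y_1\otimes\cdots\otimes y_{n-1})\otimes y_n .$$ For graphs $E,F,G$ and bimodule isomorphisms $\sigma:kE^1\otimes_{kE^0}M\to M\otimes_{kF^0}kF^1$ and $\psi:kF^1\otimes_{kF^0}N\to N\otimes_{kG^0}kG^1$ let $$\sigma\#\psi:=\alpha_{M,N,kG^1}^{-1}\circ(\mathrm{id}_M\otimes\psi)\circ\alpha_{M,kF^1,N}\circ(\sigma\otimes\mathrm{id}_N)\circ\alpha_{kE^1,M,N}^{-1}:\ kE^1\otimes(M\otimes N)\to(M\otimes N)\otimes kG^1 .$$ $L_k(E)$ is the Leavitt path algebra of $E$: the $k$-algebra generated by $v\in E^0$ and $e,e^*$ for $e\in E^1$, with the relations $vw=\delta_{v,w}v$, $s(e)e=er(e)=e$, $r(e)e^*=e^*s(e)=e^*$, $e^*f=\delta_{e,f}r(e)$, and $v=\sum_{s(e)=v}ee^*$ for every $v$ that is not a sink (its identity is $\sum_{v\in E^0}v$). It has the $\mathbb Z$-grading whose degree $n$ component is spanned by the $\alpha\beta^*$ with $\alpha,\beta$ paths and $\ell(\alpha)-\ell(\beta)=n$. For a $\mathbb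 Z$-graded ring $R$ let $\mathsf{Gr}\text{-}R$ be the category of graded right modules and degree-preserving homomorphisms, with suspensions $M(\gamma)_g=M_{\gamma+g}$, and let $U_R:\mathsf{Gr}\text{-}R\to\mathsf{Mod}\text{-}R$ forget the grading. A functor $\Phi:\mathsf{Gr}\text{-}R\to\mathsf{Gr}\text{-}S$ is graded if it commutes with all suspension functors; a functor $\varphi:\mathsf{Mod}\text{-}R\to\mathsf{Mod}\text{-}S$ is graded if $U_S\circ\Phi=\varphi\circ U_R$ for some graded $\Phi$. Call $R$ and $S$ graded Morita equivalent if (geGr) there are graded functors $\Phi:\mathsf{Gr}\text{-}R\to\mathsf{Gr}\text{-}S$ and $\Gamma:\mathsf{Gr}\text{-}S\to\mathsf{Gr}\text{-}R$ with both composites naturally isomorphic to identity functors, and (geMod) there is a graded functor $\mathsf{Mod}\text{-}R\to\mathsf{Mod}\text{-}S$ that is an equivalence of categories. **Proposition.** Let $k$ be a field and let $E$ and $F$ be finite graphs with no sinks (sources are allowed) whose adjacency matrices are strong shift equivalent. Then: 1. There exist a $kE^0$–$kF^0$-bimodule $M$, a $kF^0$–$kE^0$-bimodule $N$, an integer $n\ge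 1$ and bimodule isomorphisms $$\omega_E:M\otimes_{kF^0}N\to(kE^1)^{\otimes n},\qquad \omega_F:N\otimes_{kE^0}M\to(kF^1)^{\otimes n},$$ $$\sigma_M:kE^1\otimes_{kE^0}M\to M\otimes_{kF^0}kF^1,\qquad \sigma_N:kF^1\otimes_{kF^0}N\to N\otimes_{kE^0}kE^1$$ such that $$(\omega_E\otimes\mathrm{id})\circ(\sigma_M\#\sigma_N)=\nu_n^E\circ(\mathrm{id}\otimes\omega_E)\quad\text{and}\quad(\omega_F\otimes\mathrm{id})\circ(\sigma_N\#\sigma_M)=\nu_n^F\circ(\mathrm{id}\otimes\omega_F).$$ 2. The $\mathbb Z$-graded rings $L_k(E)$ and $L_k(F)$ are graded Morita equivalent. -/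

import Mathlib

open CategoryTheory TensorProduct MulOpposite

universe u

namespace LPA

/-! ### Balanced tensor products over a (not necessarily commutative) ring -/

section Balanced

variable {B : Type u} [Ring B] {M N : Type u} [AddCommGroup M] [Module Bᵐᵒᵖ M]
  [AddCommGroup N] [Module B N]

/-- The subgroup of `M ⊗[ℤ] N` generated by the elements `mb ⊗ n - m ⊗ bn`. -/
def balRel (B : Type u) [Ring B] (M N : Type u) [AddCommGroup M] [Module Bᵐᵒᵖ M]
    [AddCommGroup N] [Module B N] : AddSubgroup (M ⊗[ℤ] N) :=
  AddSubgroup.closure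
    {t | ∃ (m : M) (b : B) (n : N), t = (op b • m) ⊗ₜ[ℤ] n - m ⊗ₜ[ℤ] (b • n)}

/-- The tensor product `M ⊗_B N` of a right `B`-module `M` and a left `B`-module `N`. Right
`B`-modules are modules over the opposite ring `Bᵐᵒᵖ`, with `op b • m` standing for `m b`. -/
def BalTensor (B : Type u) [Ring B] (M N : Type u) [AddCommGroup M] [Module Bᵐᵒᵖ M]
    [AddCommGroup N] [Module B N] : Type u :=
  (M ⊗[ℤ] N) ⧸ balRel B M N

namespace BalTensor

instance : AddCommGroup (BalTensor B M N) :=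
  inferInstanceAs (AddCommGroup ((M ⊗[ℤ] N) ⧸ balRel B M N))

/-- The pure tensor `m ⊗ n` in `M ⊗_B N`. -/
def tmul (B : Type u) [Ring B] {M N : Type u} [AddCommGroup M] [Module Bᵐᵒᵖ M]
    [AddCommGroup N] [Module B N] (m : M) (n : N) : BalTensor B M N :=
  QuotientAddGroup.mk' (balRel B M N) (m ⊗ₜ[ℤ] n)

theorem tmul_add (m : M) (n n' : N) : tmul B m (n + n') = tmul B m n + tmul B m n' := by
  simp only [tmul, TensorProduct.tmul_add, map_add]; rfl

theorem add_tmul (m m' : M) (n : N) : tmul B (m + m') n = tmul B m n + tmul B m' n := by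
  simp only [tmul, TensorProduct.add_tmul, map_add]; rfl

theorem smul_tmul (b : B) (m : M) (n : N) : tmul B (op b • m) n = tmul B m (b • n) := by
  rw [← sub_eq_zero]
  exact (map_sub (QuotientAddGroup.mk' (balRel B M N)) _ _).symm.trans
    ((QuotientAddGroup.eq_zero_iff _).2 (AddSubgroup.subset_closure ⟨m, b, n, rfl⟩))

theorem induction {p : BalTensor B M N → Prop} (t : BalTensor B M N) (h0 : p 0)
    (ht : ∀ m n, p (tmul B m n)) (ha : ∀ x y, p x → p y → p (x + y)) : p t := by
  obtain ⟨t, rfl⟩ := QuotientAddGroup.mk'_surjective (balRel B M N) t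
  induction t using TensorProduct.induction_on with
  | zero => exact h0
  | tmul m n => exact ht m n
  | add x y hx hy => exact ha _ _ hx hy

variable {P : Type u} [AddCommGroup P]

/-- The universal property: a biadditive `B`-balanced map factors through `M ⊗_B N`. -/
def lift (f : M → N → P) (h₁ : ∀ m m' n, f (m + m') n = f m n + f m' n)
    (h₂ : ∀ m n n', f m (n + n') = f m n + f m n')
    (h₃ : ∀ (b : B) m n, f (op b • m) n = f m (b • n)) : BalTensor B M N →+ P :=
  QuotientAddGroup.lift (balRel B M N)
    (TensorProduct.liftAddHom (R := ℤ)
      (AddMonoidHom.mk' (fun m => AddMonoidHom.mk' (f m) (h₂ m))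
        fun m m' => AddMonoidHom.ext fun n => h₁ m m' n)
      fun r m n => by rw [map_zsmul, map_zsmul, AddMonoidHom.zsmul_apply]) <| by
    rw [balRel, AddSubgroup.closure_le]
    rintro _ ⟨m, b, n, rfl⟩
    simp [h₃]

@[simp]
theorem lift_tmul (f : M → N → P) (h₁ h₂) (h₃ : ∀ (b : B) m n, f (op b • m) n = f m (b • n))
    (m : M) (n : N) : lift f h₁ h₂ h₃ (tmul B m n) = f m n := rfl

theorem hom_ext {f g : BalTensor B M N →+ P} (h : ∀ m n, f (tmul B m n) = g (tmul B m n)) :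
    f = g := by
  ext t
  induction t using induction with
  | h0 => simp
  | ht m n => exact h m n
  | ha x y hx hy => simp [hx, hy]

section LeftAction

variable {A : Type u} [Ring A] [Module A M] [SMulCommClass A Bᵐᵒᵖ M]

/-- Left multiplication by `a`, that is `m ⊗ n ↦ am ⊗ n`. -/
def leftMul (a : A) : BalTensor B M N →+ BalTensor B M N :=
  lift (fun m n => tmul B (a • m) n) (fun m m' n => by rw [smul_add, add_tmul])
    (fun m n n' => tmul_add _ _ _) fun b m n => by rw [smul_comm, smul_tmul]

instance : Module A (BalTensor B M N) where
  smul a t := leftMul a t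
  one_smul t := DFunLike.congr_fun
    (hom_ext (f := leftMul (1 : A)) (g := AddMonoidHom.id _) fun m n => by simp [leftMul]) t
  mul_smul a a' t := DFunLike.congr_fun
    (hom_ext (f := leftMul (a * a')) (g := (leftMul a).comp (leftMul a')) fun m n => by
      simp [leftMul, mul_smul]) t
  smul_zero a := map_zero (leftMul a)
  smul_add a := map_add (leftMul a)
  add_smul a a' t := DFunLike.congr_fun
    (hom_ext (f := leftMul (a + a')) (g := leftMul a + leftMul a') fun m n => by
      simp [leftMul, add_smul, add_tmul]) t
  zero_smul t := DFunLike.congr_fun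
    (hom_ext (f := leftMul (0 : A)) (g := 0) fun m n => by
      have h := add_tmul (B := B) (0 : M) 0 n
      simp only [add_zero, left_eq_add] at h
      simp [leftMul, h]) t

theorem left_smul_tmul (a : A) (m : M) (n : N) : a • tmul B m n = tmul B (a • m) n := rfl

end LeftAction

section RightAction

variable {C : Type u} [Ring C] [Module Cᵐᵒᵖ N] [SMulCommClass B Cᵐᵒᵖ N]

/-- Right multiplication by `c`, that is `m ⊗ n ↦ m ⊗ nc`. -/
def rightMul (c : Cᵐᵒᵖ) : BalTensor B M N →+ BalTensor B M N :=
  lift (fun m n => tmul B m (c • n)) (fun m m' n => add_tmul _ _ _)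
    (fun m n n' => by rw [smul_add, tmul_add]) fun b m n => by rw [smul_tmul, smul_comm]

instance : Module Cᵐᵒᵖ (BalTensor B M N) where
  smul c t := rightMul c t
  one_smul t := DFunLike.congr_fun
    (hom_ext (f := rightMul (1 : Cᵐᵒᵖ)) (g := AddMonoidHom.id _) fun m n => by
      simp [rightMul]) t
  mul_smul c c' t := DFunLike.congr_fun
    (hom_ext (f := rightMul (c * c')) (g := (rightMul c).comp (rightMul c')) fun m n => by
      simp [rightMul, mul_smul]) t
  smul_zero c := map_zero (rightMul c)
  smul_add c := map_add (rightMul c)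
  add_smul c c' t := DFunLike.congr_fun
    (hom_ext (f := rightMul (c + c')) (g := rightMul c + rightMul c') fun m n => by
      simp [rightMul, add_smul, tmul_add]) t
  zero_smul t := DFunLike.congr_fun
    (hom_ext (f := rightMul (0 : Cᵐᵒᵖ)) (g := 0) fun m n => by
      have h := tmul_add (B := B) m (0 : N) 0
      simp only [add_zero, left_eq_add] at h
      simp [rightMul, h]) t

theorem right_smul_tmul (c : Cᵐᵒᵖ) (m : M) (n : N) : c • tmul B m n = tmul B m (c • n) := rfl

instance {A : Type u} [Ring A] [Module A M] [SMulCommClass A Bᵐᵒᵖ M] :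
    SMulCommClass A Cᵐᵒᵖ (BalTensor B M N) where
  smul_comm a c t := by
    induction t using induction with
    | h0 => simp
    | ht m n => rfl
    | ha x y hx hy => simp only [smul_add, hx, hy]

end RightAction

section Maps

/-- The map `m ⊗ n ↦ f m ⊗ g n` for additive maps which respect the actions of `B`. -/
def map {M' N' : Type u} [AddCommGroup M'] [Module Bᵐᵒᵖ M'] [AddCommGroup N'] [Module B N']
    (f : M →+ M') (g : N →+ N') (hf : ∀ (b : Bᵐᵒᵖ) m, f (b • m) = b • f m)
    (hg : ∀ (b : B) n, g (b • n) = b • g n) : BalTensor B M N →+ BalTensor B M' N' :=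
  lift (fun m n => tmul B (f m) (g n)) (fun m m' n => by rw [map_add, add_tmul])
    (fun m n n' => by rw [map_add, tmul_add]) fun b m n => by rw [hf, hg, smul_tmul]

variable {C : Type u} [Ring C] [Module Cᵐᵒᵖ N] [SMulCommClass B Cᵐᵒᵖ N] [Module C P]

/-- The map `(m ⊗ n) ⊗ p ↦ m ⊗ (n ⊗ p)`. -/
def assocHom : BalTensor C (BalTensor B M N) P →+ BalTensor B M (BalTensor C N P) :=
  lift
    (fun t p => lift (fun m n => tmul B m (tmul C n p)) (fun m m' n => add_tmul _ _ _)
      (fun m n n' => by rw [add_tmul, tmul_add])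
      (fun b m n => by rw [smul_tmul, left_smul_tmul]) t)
    (fun t t' p => map_add _ _ _)
    (fun t p p' => by
      induction t using induction with
      | h0 => simp
      | ht m n => simp [tmul_add]
      | ha t t' h h' => simp only [map_add, h, h']; abel)
    (fun c t p => by
      induction t using induction with
      | h0 => simp
      | ht m n => simp [right_smul_tmul, smul_tmul]
      | ha t t' h h' => simp only [smul_add, map_add, h, h'])

/-- The map `m ⊗ (n ⊗ p) ↦ (m ⊗ n) ⊗ p`. -/
def assocInv : BalTensor B M (BalTensor C N P) →+ BalTensor C (BalTensor B M N) P :=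
  lift
    (fun m t => lift (fun n p => tmul C (tmul B m n) p)
      (fun n n' p => by rw [tmul_add, add_tmul]) (fun n p p' => tmul_add _ _ _)
      (fun c n p => by rw [← smul_tmul, right_smul_tmul]) t)
    (fun m m' t => by
      induction t using induction with
      | h0 => simp
      | ht n p => simp [add_tmul]
      | ha t t' h h' => simp only [map_add, h, h']; abel)
    (fun m t t' => map_add _ _ _)
    (fun b m t => by
      induction t using induction with
      | h0 => simp
      | ht n p => simp [left_smul_tmul, smul_tmul]
      | ha t t' h h' => simp only [smul_add, map_add, h, h'])

@[simp]
theorem assocHom_tmul (m : M) (n : N) (p : P) :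
    assocHom (tmul C (tmul B m n) p) = tmul B m (tmul C n p) := rfl

@[simp]
theorem assocInv_tmul (m : M) (n : N) (p : P) :
    assocInv (tmul B m (tmul C n p)) = tmul C (tmul B m n) p := rfl

theorem induction₃ {p : BalTensor C (BalTensor B M N) P → Prop}
    (t : BalTensor C (BalTensor B M N) P) (h0 : p 0)
    (ht : ∀ m n q, p (tmul C (tmul B m n) q)) (ha : ∀ x y, p x → p y → p (x + y)) : p t := by
  induction t using induction with
  | h0 => exact h0
  | ht t q =>
    induction t using induction with
    | h0 =>
      have h := add_tmul (B := C) (0 : BalTensor B M N) 0 q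
      rw [add_zero, left_eq_add] at h
      rwa [h]
    | ht m n => exact ht m n q
    | ha x y hx hy => rw [add_tmul]; exact ha _ _ hx hy
  | ha x y hx hy => exact ha _ _ hx hy

theorem induction₃' {p : BalTensor B M (BalTensor C N P) → Prop}
    (t : BalTensor B M (BalTensor C N P)) (h0 : p 0)
    (ht : ∀ m n q, p (tmul B m (tmul C n q))) (ha : ∀ x y, p x → p y → p (x + y)) : p t := by
  induction t using induction with
  | h0 => exact h0
  | ht m t =>
    induction t using induction with
    | h0 =>
      have h := tmul_add (B := B) m (0 : BalTensor C N P) 0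
      rw [add_zero, left_eq_add] at h
      rwa [h]
    | ht n q => exact ht m n q
    | ha x y hx hy => rw [tmul_add]; exact ha _ _ hx hy
  | ha x y hx hy => exact ha _ _ hx hy

theorem assocHom_left {A : Type u} [Ring A] [Module A M] [SMulCommClass A Bᵐᵒᵖ M] (a : A)
    (t : BalTensor C (BalTensor B M N) P) : assocHom (a • t) = a • assocHom t := by
  induction t using induction₃ with
  | h0 => simp
  | ht m n p => rw [left_smul_tmul, left_smul_tmul, assocHom_tmul, assocHom_tmul, left_smul_tmul]
  | ha x y hx hy => simp only [smul_add, map_add, hx, hy]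

theorem assocInv_left {A : Type u} [Ring A] [Module A M] [SMulCommClass A Bᵐᵒᵖ M] (a : A)
    (t : BalTensor B M (BalTensor C N P)) : assocInv (a • t) = a • assocInv t := by
  induction t using induction₃' with
  | h0 => simp
  | ht m n p => rw [left_smul_tmul, assocInv_tmul, assocInv_tmul, left_smul_tmul, left_smul_tmul]
  | ha x y hx hy => simp only [smul_add, map_add, hx, hy]

theorem assocInv_assocHom (t : BalTensor C (BalTensor B M N) P) :
    assocInv (assocHom t) = t := by
  induction t using induction₃ with
  | h0 => simp
  | ht m n p => rw [assocHom_tmul, assocInv_tmul]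
  | ha x y hx hy => simp only [map_add, hx, hy]

theorem assocHom_assocInv (t : BalTensor B M (BalTensor C N P)) :
    assocHom (assocInv t) = t := by
  induction t using induction₃' with
  | h0 => simp
  | ht m n p => rw [assocInv_tmul, assocHom_tmul]
  | ha x y hx hy => simp only [map_add, hx, hy]

variable {D : Type u} [Ring D] [Module Dᵐᵒᵖ P] [SMulCommClass C Dᵐᵒᵖ P]

theorem assocHom_right (d : Dᵐᵒᵖ) (t : BalTensor C (BalTensor B M N) P) :
    assocHom (d • t) = d • assocHom t := by
  induction t using induction₃ with
  | h0 => simp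
  | ht m n p => rw [right_smul_tmul, assocHom_tmul, assocHom_tmul, right_smul_tmul, right_smul_tmul]
  | ha x y hx hy => simp only [smul_add, map_add, hx, hy]

theorem assocInv_right (d : Dᵐᵒᵖ) (t : BalTensor B M (BalTensor C N P)) :
    assocInv (d • t) = d • assocInv t := by
  induction t using induction₃' with
  | h0 => simp
  | ht m n p => rw [right_smul_tmul, right_smul_tmul, assocInv_tmul, assocInv_tmul, right_smul_tmul]
  | ha x y hx hy => simp only [smul_add, map_add, hx, hy]

end Maps

end BalTensor

end Balanced

/-! ### The category of bimodules -/

/-- An `A`--`B`-bimodule for `k`-algebras `A` and `B`: commuting left `A`- and right `B`-module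
structures, on which the scalars of `k` act in the same way from both sides. -/
structure Bimodule (k A B : Type u) [Field k] [Ring A] [Algebra k A] [Ring B] [Algebra k B] where
  carrier : Type u
  [addCommGroup : AddCommGroup carrier]
  [left : Module A carrier]
  [right : Module Bᵐᵒᵖ carrier]
  [comm : SMulCommClass A Bᵐᵒᵖ carrier]
  central : ∀ (c : k) (m : carrier), algebraMap k A c • m = op (algebraMap k B c) • m

namespace Bimodule

attribute [instance] Bimodule.addCommGroup Bimodule.left Bimodule.right Bimodule.comm

variable {k A B C D : Type u} [Field k] [Ring A] [Algebra k A] [Ring B] [Algebra k B]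
  [Ring C] [Algebra k C] [Ring D] [Algebra k D]

/-- Homomorphisms of bimodules. -/
@[ext]
structure Hom (M N : Bimodule k A B) where
  toHom : M.carrier →+ N.carrier
  map_left : ∀ (a : A) (m : M.carrier), toHom (a • m) = a • toHom m
  map_right : ∀ (b : Bᵐᵒᵖ) (m : M.carrier), toHom (b • m) = b • toHom m

/-- The category of `A`--`B`-bimodules; its isomorphisms are the bimodule isomorphisms. -/
instance : Category (Bimodule k A B) where
  Hom M N := Hom M N
  id M := ⟨AddMonoidHom.id _, fun _ _ => rfl, fun _ _ => rfl⟩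
  comp f g := ⟨g.toHom.comp f.toHom, fun a m => by simp [f.map_left, g.map_left],
    fun b m => by simp [f.map_right, g.map_right]⟩

theorem hom_ext {M N : Bimodule k A B} {f g : M ⟶ N}
    (h : ∀ m, Hom.toHom f m = Hom.toHom g m) : f = g :=
  Hom.ext (AddMonoidHom.ext h)

/-- The bimodule `M ⊗_B N`. -/
abbrev tensor (M : Bimodule k A B) (N : Bimodule k B C) : Bimodule k A C where
  carrier := BalTensor B M.carrier N.carrier
  central c t := by
    induction t using BalTensor.induction with
    | h0 => simp
    | ht m n =>
      rw [BalTensor.left_smul_tmul, BalTensor.right_smul_tmul, M.central, BalTensor.smul_tmul,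
        N.central]
    | ha x y hx hy => rw [smul_add, smul_add, hx, hy]

/-- The bimodule homomorphism `f ⊗ g`. -/
def tensorHom {M M' : Bimodule k A B} {N N' : Bimodule k B C} (f : M ⟶ M') (g : N ⟶ N') :
    tensor M N ⟶ tensor M' N' where
  toHom := BalTensor.map (Hom.toHom f) (Hom.toHom g) (Hom.map_right f) (Hom.map_left g)
  map_left a t := DFunLike.congr_fun (BalTensor.hom_ext
    (f := (BalTensor.map (B := B) f.toHom g.toHom f.map_right g.map_left).comp
      (BalTensor.leftMul a))
    (g := (BalTensor.leftMul a).comp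
      (BalTensor.map (B := B) f.toHom g.toHom f.map_right g.map_left))
    fun m n => congrArg (fun x => BalTensor.tmul B x (g.toHom n)) (f.map_left a m)) t
  map_right c t := DFunLike.congr_fun (BalTensor.hom_ext
    (f := (BalTensor.map (B := B) f.toHom g.toHom f.map_right g.map_left).comp
      (BalTensor.rightMul c))
    (g := (BalTensor.rightMul c).comp
      (BalTensor.map (B := B) f.toHom g.toHom f.map_right g.map_left))
    fun m n => congrArg (fun x => BalTensor.tmul B (f.toHom m) x) (g.map_right c n)) t

/-- The bimodule isomorphism `f ⊗ g` for bimodule isomorphisms `f` and `g`. -/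
def tensorIso {M M' : Bimodule k A B} {N N' : Bimodule k B C} (f : M ≅ M') (g : N ≅ N') :
    tensor M N ≅ tensor M' N' where
  hom := tensorHom f.hom g.hom
  inv := tensorHom f.inv g.inv
  hom_inv_id := Hom.ext <| BalTensor.hom_ext fun m n => by
    have hf := DFunLike.congr_fun (congrArg Hom.toHom f.hom_inv_id) m
    have hg := DFunLike.congr_fun (congrArg Hom.toHom g.hom_inv_id) n
    exact congrArg₂ (BalTensor.tmul B) hf hg
  inv_hom_id := Hom.ext <| BalTensor.hom_ext fun m n => by
    have hf := DFunLike.congr_fun (congrArg Hom.toHom f.inv_hom_id) m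
    have hg := DFunLike.congr_fun (congrArg Hom.toHom g.inv_hom_id) n
    exact congrArg₂ (BalTensor.tmul B) hf hg

/-- The associativity isomorphism `α_{X,Y,Z}`, `(x ⊗ y) ⊗ z ↦ x ⊗ (y ⊗ z)`. -/
def assoc (X : Bimodule k A B) (Y : Bimodule k B C) (Z : Bimodule k C D) :
    tensor (tensor X Y) Z ≅ tensor X (tensor Y Z) where
  hom := ⟨BalTensor.assocHom, BalTensor.assocHom_left, BalTensor.assocHom_right⟩
  inv := ⟨BalTensor.assocInv, BalTensor.assocInv_left, BalTensor.assocInv_right⟩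
  hom_inv_id := Hom.ext (AddMonoidHom.ext BalTensor.assocInv_assocHom)
  inv_hom_id := Hom.ext (AddMonoidHom.ext BalTensor.assocHom_assocInv)

/-- `tpow X m` is the tensor power `X ⊗ ⋯ ⊗ X` (nested to the left) with `m + 1` factors. -/
def tpow (X : Bimodule k A A) : ℕ → Bimodule k A A
  | 0 => X
  | m + 1 => tensor (tpow X m) X

/-- The isomorphism `x₁ ⊗ (y₁ ⊗ ⋯ ⊗ yₙ) ↦ (x₁ ⊗ y₁ ⊗ ⋯ ⊗ yₙ₋₁) ⊗ yₙ` from `X ⊗ X^{⊗ n}`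
to `X^{⊗ n} ⊗ X`, for `n = m + 1`. -/
def nu (X : Bimodule k A A) : (m : ℕ) → (tensor X (tpow X m) ≅ tensor (tpow X m) X)
  | 0 => Iso.refl _
  | m + 1 => (assoc X (tpow X m) X).symm ≪≫ tensorIso (nu X m) (Iso.refl X)

/-- For `σ : X ⊗ M ≅ M ⊗ Y` and `ψ : Y ⊗ N ≅ N ⊗ Z` the isomorphism
`σ # ψ : X ⊗ (M ⊗ N) ≅ (M ⊗ N) ⊗ Z`, namely
`α_{M,N,Z}⁻¹ ∘ (id_M ⊗ ψ) ∘ α_{M,Y,N} ∘ (σ ⊗ id_N) ∘ α_{X,M,N}⁻¹`. -/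
def hashIso {X : Bimodule k A A} {Y : Bimodule k B B} {Z : Bimodule k C C}
    {M : Bimodule k A B} {N : Bimodule k B C}
    (σ : tensor X M ≅ tensor M Y) (ψ : tensor Y N ≅ tensor N Z) :
    tensor X (tensor M N) ≅ tensor (tensor M N) Z :=
  (assoc X M N).symm ≪≫ tensorIso σ (Iso.refl N) ≪≫ assoc M Y N ≪≫
    tensorIso (Iso.refl M) ψ ≪≫ (assoc M N Z).symm

end Bimodule

/-! ### Graphs -/

/-- A finite directed graph (loops and parallel edges are allowed). -/
structure FiniteGraph where
  Vert : Type u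
  Edge : Type u
  [fintypeVert : Fintype Vert]
  [fintypeEdge : Fintype Edge]
  s : Edge → Vert
  r : Edge → Vert

namespace FiniteGraph

attribute [instance] FiniteGraph.fintypeVert FiniteGraph.fintypeEdge

/-- No vertex is a sink. -/
def NoSinks (E : FiniteGraph.{u}) : Prop := ∀ v : E.Vert, ∃ e : E.Edge, E.s e = v

/-- The adjacency matrix. -/
noncomputable def adjMatrix (E : FiniteGraph.{u}) : Matrix E.Vert E.Vert ℕ :=
  fun v w => Nat.card {e : E.Edge // E.s e = v ∧ E.r e = w}

/-- The algebra `kE⁰` with basis the vertices and product `v w = δ_{v,w} v`: the functions on the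
(finite) vertex set with pointwise operations, a vertex `v` being `Pi.single v 1`. -/
abbrev VertexAlg (k : Type u) [Field k] (E : FiniteGraph.{u}) : Type u := E.Vert → k

/-- The vector space `kE¹` with basis the edges: the functions on the (finite) edge set, an edge
`e` being `Pi.single e 1`. -/
def EdgeSpace (k : Type u) [Field k] (E : FiniteGraph.{u}) : Type u := E.Edge → k

section EdgeSpace

variable (k : Type u) [Field k] (E : FiniteGraph.{u})

instance : AddCommGroup (EdgeSpace k E) := inferInstanceAs (AddCommGroup (E.Edge → k))

/-- The left action with `v · e = e` if `s(e) = v` and `v · e = 0` otherwise. -/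
instance : Module (VertexAlg k E) (EdgeSpace k E) where
  smul a x := fun e => a (E.s e) * x e
  one_smul _ := funext fun _ => one_mul _
  mul_smul _ _ _ := funext fun _ => mul_assoc _ _ _
  smul_zero _ := funext fun _ => mul_zero _
  smul_add _ _ _ := funext fun _ => mul_add _ _ _
  add_smul _ _ _ := funext fun _ => add_mul _ _ _
  zero_smul _ := funext fun _ => zero_mul _

/-- The right action with `e · w = e` if `r(e) = w` and `e · w = 0` otherwise. -/
instance : Module (VertexAlg k E)ᵐᵒᵖ (EdgeSpace k E) where
  smul b x := fun e => x e * b.unop (E.r e)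
  one_smul _ := funext fun _ => mul_one _
  mul_smul _ _ _ := funext fun _ => (mul_assoc _ _ _).symm
  smul_zero _ := funext fun _ => zero_mul _
  smul_add _ _ _ := funext fun _ => add_mul _ _ _
  add_smul _ _ _ := funext fun _ => mul_add _ _ _
  zero_smul _ := funext fun _ => mul_zero _

/-- The `kE⁰`--`kE⁰`-bimodule `kE¹`. -/
abbrev edgeBimodule : Bimodule k (VertexAlg k E) (VertexAlg k E) where
  carrier := EdgeSpace k E
  comm := ⟨fun a b x => funext fun e => (mul_assoc (a (E.s e)) (x e) (b.unop (E.r e))).symm⟩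
  central c x := funext fun e => mul_comm c (x e)

end EdgeSpace

/-- Paths from a vertex to another one; the vertices are the paths of length zero. -/
inductive Path (E : FiniteGraph.{u}) : E.Vert → E.Vert → Type u
  | nil (v : E.Vert) : Path E v v
  | cons (e : E.Edge) {w : E.Vert} (p : Path E (E.r e) w) : Path E (E.s e) w

/-- The length of a path. -/
def Path.length {E : FiniteGraph.{u}} : {v w : E.Vert} → Path E v w → ℕ
  | _, _, .nil _ => 0
  | _, _, .cons _ p => p.length + 1

end FiniteGraph

/-! ### Leavitt path algebras -/

/-- The generators `v`, `e` and `e*` of the Leavitt path algebra. -/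
inductive LeavittGen (E : FiniteGraph.{u}) : Type u
  | vert (v : E.Vert)
  | edge (e : E.Edge)
  | ghost (e : E.Edge)

section Leavitt

variable (k : Type u) [Field k] (E : FiniteGraph.{u})

/-- A generator as an element of the free unital algebra. -/
abbrev gen (x : LeavittGen E) : FreeAlgebra k (LeavittGen E) := FreeAlgebra.ι k x

open LeavittGen in
open scoped Classical in
/-- The defining relations (V), (E1), (E2), (CK1), (CK2). As the presentation is one of unital
algebras, it also has to say that the sum of the vertices is the identity. -/
inductive LeavittRel : FreeAlgebra k (LeavittGen E) → FreeAlgebra k (LeavittGen E) → Prop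
  | one : LeavittRel (∑ v, gen k E (vert v)) 1
  | vert_mul (v w : E.Vert) :
      LeavittRel (gen k E (vert v) * gen k E (vert w)) (if v = w then gen k E (vert v) else 0)
  | source_edge (e : E.Edge) :
      LeavittRel (gen k E (vert (E.s e)) * gen k E (edge e)) (gen k E (edge e))
  | edge_range (e : E.Edge) :
      LeavittRel (gen k E (edge e) * gen k E (vert (E.r e))) (gen k E (edge e))
  | range_ghost (e : E.Edge) :
      LeavittRel (gen k E (vert (E.r e)) * gen k E (ghost e)) (gen k E (ghost e))
  | ghost_source (e : E.Edge) :
      LeavittRel (gen k E (ghost e) * gen k E (vert (E.s e))) (gen k E (ghost e))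
  | ck1 (e f : E.Edge) :
      LeavittRel (gen k E (ghost e) * gen k E (edge f))
        (if e = f then gen k E (vert (E.r e)) else 0)
  | ck2 (v : E.Vert) (hv : ∃ e, E.s e = v) :
      LeavittRel (gen k E (vert v))
        (∑ e with E.s e = v, gen k E (edge e) * gen k E (ghost e))

/-- The Leavitt path algebra `L_k(E)` of the finite graph `E`. -/
abbrev Leavitt : Type u := RingQuot (LeavittRel k E)

namespace Leavitt

/-- A generator as an element of the Leavitt path algebra. -/
def of (x : LeavittGen E) : Leavitt k E := RingQuot.mkAlgHom k (LeavittRel k E) (gen k E x)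

variable {E}

/-- The element `e₁ e₂ ⋯ eₙ` given by a path. -/
def path : {v w : E.Vert} → E.Path v w → Leavitt k E
  | v, _, .nil _ => of k E (.vert v)
  | _, _, .cons e p => of k E (.edge e) * path p

/-- The element `eₙ* ⋯ e₂* e₁*` given by a path. -/
def ghostPath : {v w : E.Vert} → E.Path v w → Leavitt k E
  | v, _, .nil _ => of k E (.vert v)
  | _, _, .cons e p => ghostPath p * of k E (.ghost e)

variable (E)

/-- The standard grading: the component of degree `n` is spanned by the elements `α β*` with paths
`α`, `β` for which `ℓ(α) - ℓ(β) = n`. (If the ranges of the paths differ, `α β* = 0`.) -/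
def grading (n : ℤ) : AddSubgroup (Leavitt k E) :=
  (Submodule.span k {x | ∃ (u v w : E.Vert) (α : E.Path u w) (β : E.Path v w),
    (α.length : ℤ) - β.length = n ∧ x = path k α * ghostPath k β}).toAddSubgroup

end Leavitt

end Leavitt

/-! ### Graded modules and graded Morita equivalence -/

/-- A `ℤ`-graded right module over the ring `R` with the grading `𝒜`. -/
structure GrMod (R : Type u) [Ring R] (𝒜 : ℤ → AddSubgroup R) where
  toMod : ModuleCat.{u} Rᵐᵒᵖ
  deg : ℤ → AddSubgroup toMod
  isInternal : DirectSum.IsInternal deg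
  smul_mem : ∀ ⦃g h : ℤ⦄ ⦃m : toMod⦄ ⦃a : R⦄, m ∈ deg g → a ∈ 𝒜 h → op a • m ∈ deg (g + h)

namespace GrMod

variable {R : Type u} [Ring R] {𝒜 : ℤ → AddSubgroup R}

/-- Graded homomorphisms: the homomorphisms of modules which map each component `M_g` to `N_g`. -/
@[ext]
structure Hom (M N : GrMod R 𝒜) where
  toHom : M.toMod ⟶ N.toMod
  map_deg : ∀ (g : ℤ) (m : M.toMod), m ∈ M.deg g → toHom m ∈ N.deg g

/-- The category `Gr-R`. -/
instance : Category (GrMod R 𝒜) where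
  Hom M N := Hom M N
  id M := ⟨𝟙 _, fun _ _ hm => hm⟩
  comp f f' := ⟨f.toHom ≫ f'.toHom, fun g m hm => f'.map_deg g _ (f.map_deg g m hm)⟩

variable (R 𝒜)

/-- The functor from `Gr-R` to `Mod-R` which forgets the grading. -/
def forgetGr : GrMod R 𝒜 ⥤ ModuleCat.{u} Rᵐᵒᵖ where
  obj M := M.toMod
  map f := Hom.toHom f

variable {R 𝒜}

/-- The suspension `M(γ)`, with `M(γ)_g = M_{γ + g}`. -/
def shift (γ : ℤ) (M : GrMod R 𝒜) : GrMod R 𝒜 where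
  toMod := M.toMod
  deg g := M.deg (γ + g)
  isInternal := by
    have h : DirectSum.coeAddMonoidHom (fun g => M.deg (γ + g)) =
        (DirectSum.coeAddMonoidHom M.deg).comp
          (DirectSum.equivCongrLeft (β := fun g => M.deg g)
            (Equiv.addLeft γ).symm).symm.toAddMonoidHom := by
      refine DirectSum.addHom_ext fun g m => ?_
      have e : (DirectSum.equivCongrLeft (β := fun g => M.deg g) (Equiv.addLeft γ).symm)
          (DirectSum.of (fun g => M.deg g) (γ + g) m) =
            DirectSum.of (fun g => M.deg (γ + g)) g m :=
        DirectSum.equivCongrLeft_of (β := fun g => M.deg g) (Equiv.addLeft γ).symm g m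
      have e' := (AddEquiv.eq_symm_apply _).2 e
      exact (DirectSum.coeAddMonoidHom_of (fun g => M.deg (γ + g)) g m).trans
        ((DirectSum.coeAddMonoidHom_of M.deg (γ + g) m).symm.trans
          (congrArg (DirectSum.coeAddMonoidHom M.deg) e'))
    rw [DirectSum.IsInternal, h]
    exact M.isInternal.comp (AddEquiv.bijective _)
  smul_mem g h m a hm ha := by
    rw [← add_assoc]
    exact M.smul_mem hm ha

variable (R 𝒜)

/-- The suspension functor, which is the identity on morphisms. -/
def shiftFunctor (γ : ℤ) : GrMod R 𝒜 ⥤ GrMod R 𝒜 where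
  obj M := shift γ M
  map {M N} f := Hom.mk (M := shift γ M) (N := shift γ N) (Hom.toHom (M := M) (N := N) f)
    fun g m hm => Hom.map_deg (M := M) (N := N) f (γ + g) m hm

end GrMod

section Morita

variable {R S : Type u} [Ring R] [Ring S] {𝒜 : ℤ → AddSubgroup R} {ℬ : ℤ → AddSubgroup S}

/-- A functor from `Gr-R` to `Gr-S` is graded if it commutes with all suspensions. -/
def IsGradedFunctorGr (Φ : GrMod R 𝒜 ⥤ GrMod S ℬ) : Prop :=
  ∀ γ : ℤ, Φ ⋙ GrMod.shiftFunctor S ℬ γ = GrMod.shiftFunctor R 𝒜 γ ⋙ Φ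

variable (𝒜 ℬ)

/-- A functor from `Mod-R` to `Mod-S` is graded if it is covered by a graded functor from `Gr-R` to
`Gr-S`. -/
def IsGradedFunctorMod (φ : ModuleCat.{u} Rᵐᵒᵖ ⥤ ModuleCat.{u} Sᵐᵒᵖ) : Prop :=
  ∃ Φ : GrMod R 𝒜 ⥤ GrMod S ℬ, IsGradedFunctorGr Φ ∧
    Φ ⋙ GrMod.forgetGr S ℬ = GrMod.forgetGr R 𝒜 ⋙ φ

/-- There is a graded equivalence from `Gr-R` to `Gr-S`. -/
def GradedEquivalentGr : Prop :=
  ∃ (Φ : GrMod R 𝒜 ⥤ GrMod S ℬ) (Γ : GrMod S ℬ ⥤ GrMod R 𝒜),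
    IsGradedFunctorGr Φ ∧ IsGradedFunctorGr Γ ∧
      Nonempty (Φ ⋙ Γ ≅ 𝟭 _) ∧ Nonempty (Γ ⋙ Φ ≅ 𝟭 _)

/-- There is a graded equivalence from `Mod-R` to `Mod-S`. -/
def GradedEquivalentMod : Prop :=
  ∃ (φ : ModuleCat.{u} Rᵐᵒᵖ ⥤ ModuleCat.{u} Sᵐᵒᵖ) (τ : ModuleCat.{u} Sᵐᵒᵖ ⥤ ModuleCat.{u} Rᵐᵒᵖ),
    IsGradedFunctorMod 𝒜 ℬ φ ∧ Nonempty (φ ⋙ τ ≅ 𝟭 _) ∧ Nonempty (τ ⋙ φ ≅ 𝟭 _)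

/-- Graded Morita equivalence of the graded rings `R` and `S`, in the form which asks both for a
graded equivalence of the categories of graded modules and for one of the categories of modules. -/
def GradedMoritaEquivalent : Prop := GradedEquivalentGr 𝒜 ℬ ∧ GradedEquivalentMod 𝒜 ℬ

end Morita

/-! ### Strong shift equivalence -/

/-- A square matrix over the nonnegative integers, with an arbitrary finite index set. -/
structure SquareMatrix where
  ι : Type u
  [fintype : Fintype ι]
  mat : Matrix ι ι ℕ

attribute [instance] SquareMatrix.fintype

/-- Elementary strong shift equivalence: `A = RS` and `B = SR`. -/
def ElementarySSE (A B : SquareMatrix.{u}) : Prop :=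
  ∃ (R : Matrix A.ι B.ι ℕ) (S : Matrix B.ι A.ι ℕ), A.mat = R * S ∧ B.mat = S * R

/-- Strong shift equivalence, the transitive closure of elementary strong shift equivalence. -/
def StrongShiftEquivalent (A B : SquareMatrix.{u}) : Prop := Relation.TransGen ElementarySSE A B

/-- The adjacency matrix of a graph as a square matrix. -/
noncomputable def FiniteGraph.adj (E : FiniteGraph.{u}) : SquareMatrix.{u} := ⟨E.Vert, E.adjMatrix⟩

/-! ### Module shift equivalence with commuting diagrams -/

open Bimodule FiniteGraph in
/-- There are a `kE⁰`--`kF⁰`-bimodule `M`, a `kF⁰`--`kE⁰`-bimodule `N`, a positive integer `n`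
(written as `m + 1`) and bimodule isomorphisms `ω_E : M ⊗ N ≅ (kE¹)^{⊗ n}`,
`ω_F : N ⊗ M ≅ (kF¹)^{⊗ n}`, `σ_M : kE¹ ⊗ M ≅ M ⊗ kF¹` and `σ_N : kF¹ ⊗ N ≅ N ⊗ kE¹` with
`(ω_E ⊗ id) ∘ (σ_M # σ_N) = ν_n^E ∘ (id ⊗ ω_E)` and
`(ω_F ⊗ id) ∘ (σ_N # σ_M) = ν_n^F ∘ (id ⊗ ω_F)`. -/
def CompatibleModuleShiftEquivalent (k : Type u) [Field k] (E F : FiniteGraph.{u}) : Prop :=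
  ∃ (M : Bimodule k (VertexAlg k E) (VertexAlg k F))
    (N : Bimodule k (VertexAlg k F) (VertexAlg k E)) (m : ℕ)
    (ωE : tensor M N ≅ tpow (edgeBimodule k E) m)
    (ωF : tensor N M ≅ tpow (edgeBimodule k F) m)
    (σM : tensor (edgeBimodule k E) M ≅ tensor M (edgeBimodule k F))
    (σN : tensor (edgeBimodule k F) N ≅ tensor N (edgeBimodule k E)),
    (hashIso σM σN).hom ≫ tensorHom ωE.hom (𝟙 (edgeBimodule k E)) =
        tensorHom (𝟙 (edgeBimodule k E)) ωE.hom ≫ (nu (edgeBimodule k E) m).hom ∧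
      (hashIso σN σM).hom ≫ tensorHom ωF.hom (𝟙 (edgeBimodule k F)) =
        tensorHom (𝟙 (edgeBimodule k F)) ωF.hom ≫ (nu (edgeBimodule k F) m).hom

end LPA

/-! Part 1. A pair `(M, σ)` with `σ : X ⊗ M ≅ M ⊗ Y` behaves like an arrow from `X` to `Y`, and `#`
is the composition of such arrows. Call two pairs intertwined if an isomorphism of the underlying
bimodules carries one structure map to the other; the two required squares say exactly that `σ_M #
σ_N` and `σ_N # σ_M` are intertwined with `ν_n^E` and `ν_n^F`. Up to intertwining, `#` is
associative (`hash_assoc`), `ν_n` is the `n`-fold `#`-power of the pair `(X, id)` (`nu_succ`), and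
this power slides past any pair (`slide_nu`), the intertwiner for one factor being `σ` itself. Hence
shift equivalences compose and their lags add (`ShiftEquivalent.trans`).

It remains to treat `A = RS`, `B = SR`. Let `R` and `S` be the edge sets of a bipartite graph on `E⁰
⊔ F⁰` whose paths of length two are the edges of `E` and of `F`, and let `M = kR`, `N = kS`. Then `M
⊗ N ≅ kE¹` and `N ⊗ M ≅ kF¹`, and rebracketing `(M ⊗ N) ⊗ M` gives `σ_M`, likewise `σ_N`; the
squares commute with `n = 1` (`intertwined_exchangeIso`).

Part 2. For the same bipartite graph, a right `L_k(E)`-module `M` is sent to the formal sums `∑ n(b)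
b*` over `b ∈ S` with `n(b) ∈ M r(b)`. Multiplying formally by edges `ba` and ghost edges `(ba)* =
a* b*` of `F`, and expanding with (CK1) and (CK2), gives a right `L_k(F)`-module (`Transfer`,
`freeAction_rel`). Doing this twice gives sums `∑ n(a,b) (ab)*`, which evaluate in `M`; the inverse
is `m ↦ (m ab)`, again by (CK1) and (CK2). As `ab` has degree 1, the functors on graded modules are
inverse to each other up to a suspension by 1, which is absorbed into one of them.

This needs graphs without sinks, while a chain of elementary equivalences may pass through matrices
with zero rows. So every matrix of the chain is first restricted to the indices at which an infinite
path begins (`trim`). The restriction respects elementary equivalence, and at the two ends it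
removes nothing. -/

namespace LPA

open FiniteGraph

/-! ### Zero and finite sums in balanced tensor products. -/

namespace BalTensor

variable {B : Type u} [Ring B] {M N : Type u} [AddCommGroup M] [Module Bᵐᵒᵖ M]
  [AddCommGroup N] [Module B N]

@[simp]
theorem zero_tmul (n : N) : tmul B (0 : M) n = 0 := by
  have h := add_tmul (B := B) (0 : M) 0 n
  rwa [add_zero, left_eq_add] at h

@[simp]
theorem tmul_zero (m : M) : tmul B m (0 : N) = 0 := by
  have h := tmul_add (B := B) m (0 : N) 0
  rwa [add_zero, left_eq_add] at h

theorem tmul_sum {ι : Type*} (s : Finset ι) (m : M) (f : ι → N) :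
    tmul B m (∑ i ∈ s, f i) = ∑ i ∈ s, tmul B m (f i) :=
  map_sum (AddMonoidHom.mk' (tmul B m) (tmul_add m)) f s

theorem sum_tmul {ι : Type*} (s : Finset ι) (f : ι → M) (n : N) :
    tmul B (∑ i ∈ s, f i) n = ∑ i ∈ s, tmul B (f i) n :=
  map_sum (AddMonoidHom.mk' (fun m => tmul B m n) fun m m' => add_tmul m m' n) f s

end BalTensor

/-! ### The calculus of `#` up to intertwining. -/

namespace Bimodule

open BalTensor

variable {k A B C D G : Type u} [Field k] [Ring A] [Algebra k A] [Ring B] [Algebra k B]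
  [Ring C] [Algebra k C] [Ring D] [Algebra k D] [Ring G] [Algebra k G]

theorem tensor_ext {M : Bimodule k A B} {N : Bimodule k B C} {P : Bimodule k A C}
    {f g : tensor M N ⟶ P}
    (h : ∀ m n, Hom.toHom f (tmul B m n) = Hom.toHom g (tmul B m n)) : f = g :=
  Hom.ext (BalTensor.hom_ext h)

theorem tensor_ext₃ {M : Bimodule k A B} {N : Bimodule k B C} {P : Bimodule k C D}
    {Q : Bimodule k A D} {f g : tensor M (tensor N P) ⟶ Q}
    (h : ∀ m n p, Hom.toHom f (tmul B m (tmul C n p)) = Hom.toHom g (tmul B m (tmul C n p))) :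
    f = g :=
  hom_ext fun t => by
    induction t using BalTensor.induction₃' with
    | h0 => simp only [map_zero]
    | ht m n p => exact h m n p
    | ha x y hx hy => simp only [map_add, hx, hy]

theorem iso_hom_inv_apply {M N : Bimodule k A B} (f : M ≅ N) (m : M.carrier) :
    Hom.toHom f.inv (Hom.toHom f.hom m) = m :=
  DFunLike.congr_fun (congrArg Hom.toHom f.hom_inv_id) m

theorem iso_inv_hom_apply {M N : Bimodule k A B} (f : M ≅ N) (n : N.carrier) :
    Hom.toHom f.hom (Hom.toHom f.inv n) = n :=
  DFunLike.congr_fun (congrArg Hom.toHom f.inv_hom_id) n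

theorem tensorHom_id (M : Bimodule k A B) (N : Bimodule k B C) :
    tensorHom (𝟙 M) (𝟙 N) = 𝟙 (tensor M N) :=
  tensor_ext fun _ _ => rfl

theorem tensorHom_comp {M M' M'' : Bimodule k A B} {N N' N'' : Bimodule k B C} (f : M ⟶ M')
    (f' : M' ⟶ M'') (g : N ⟶ N') (g' : N' ⟶ N'') :
    tensorHom (f ≫ f') (g ≫ g') = tensorHom f g ≫ tensorHom f' g' :=
  tensor_ext fun _ _ => rfl

/-- Isomorphisms `σ : X ⊗ M ≅ M ⊗ Y` and `σ' : X ⊗ M' ≅ M' ⊗ Y` are intertwined if they correspond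
to each other under some isomorphism `M ≅ M'`. -/
def Intertwined {X : Bimodule k A A} {Y : Bimodule k B B} {M M' : Bimodule k A B}
    (σ : tensor X M ≅ tensor M Y) (σ' : tensor X M' ≅ tensor M' Y) : Prop :=
  ∃ f : M ≅ M', σ.hom ≫ tensorHom f.hom (𝟙 Y) = tensorHom (𝟙 X) f.hom ≫ σ'.hom

namespace Intertwined

variable {X : Bimodule k A A} {Y : Bimodule k B B} {Z : Bimodule k C C} {W : Bimodule k D D}
  {M M' M'' : Bimodule k A B} {N N' : Bimodule k B C} {P : Bimodule k C D}

theorem refl (σ : tensor X M ≅ tensor M Y) : Intertwined σ σ :=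
  ⟨Iso.refl M, by simp [tensorHom_id]⟩

theorem symm {σ : tensor X M ≅ tensor M Y} {σ' : tensor X M' ≅ tensor M' Y}
    (h : Intertwined σ σ') : Intertwined σ' σ := by
  obtain ⟨f, hf⟩ := h
  refine ⟨f.symm, ?_⟩
  have h₁ : tensorHom f.hom (𝟙 Y) ≫ tensorHom f.inv (𝟙 Y) = 𝟙 _ := by
    rw [← tensorHom_comp]; simp [tensorHom_id]
  have h₂ : tensorHom (𝟙 X) f.inv ≫ tensorHom (𝟙 X) f.hom = 𝟙 _ := by
    rw [← tensorHom_comp]; simp [tensorHom_id]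
  calc σ'.hom ≫ tensorHom f.inv (𝟙 Y)
      = (tensorHom (𝟙 X) f.inv ≫ tensorHom (𝟙 X) f.hom) ≫ σ'.hom ≫ tensorHom f.inv (𝟙 Y) := by
        rw [h₂, Category.id_comp]
    _ = tensorHom (𝟙 X) f.inv ≫ (σ.hom ≫ tensorHom f.hom (𝟙 Y)) ≫ tensorHom f.inv (𝟙 Y) := by
        rw [hf]; simp only [Category.assoc]
    _ = tensorHom (𝟙 X) f.inv ≫ σ.hom := by rw [Category.assoc, h₁, Category.comp_id]

theorem trans {σ : tensor X M ≅ tensor M Y} {σ' : tensor X M' ≅ tensor M' Y}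
    {σ'' : tensor X M'' ≅ tensor M'' Y} (h : Intertwined σ σ') (h' : Intertwined σ' σ'') :
    Intertwined σ σ'' := by
  obtain ⟨f, hf⟩ := h
  obtain ⟨g, hg⟩ := h'
  refine ⟨f ≪≫ g, ?_⟩
  have h₁ : tensorHom (f.hom ≫ g.hom) (𝟙 Y) = tensorHom f.hom (𝟙 Y) ≫ tensorHom g.hom (𝟙 Y) := by
    rw [← tensorHom_comp, Category.comp_id]
  have h₂ : tensorHom (𝟙 X) (f.hom ≫ g.hom) = tensorHom (𝟙 X) f.hom ≫ tensorHom (𝟙 X) g.hom := by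
    rw [← tensorHom_comp, Category.comp_id]
  rw [Iso.trans_hom, h₁, h₂, Category.assoc, ← hg, reassoc_of% hf]

/-- If `f` and `g` intertwine the two factors, then `f ⊗ g` intertwines the composites, by
naturality of the associativity isomorphisms. -/
theorem hash {σ : tensor X M ≅ tensor M Y} {σ' : tensor X M' ≅ tensor M' Y}
    {τ : tensor Y N ≅ tensor N Z} {τ' : tensor Y N' ≅ tensor N' Z}
    (h : Intertwined σ σ') (h' : Intertwined τ τ') :
    Intertwined (hashIso σ τ) (hashIso σ' τ') := by
  obtain ⟨f, hf⟩ := h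
  obtain ⟨g, hg⟩ := h'
  refine ⟨tensorIso f g, tensor_ext₃ fun x m n => ?_⟩
  have hf' : Hom.toHom (tensorHom f.hom (𝟙 Y)) (Hom.toHom σ.hom (tmul A x m)) =
    Hom.toHom σ'.hom (tmul A x (Hom.toHom f.hom m)) :=
      DFunLike.congr_fun (congrArg Hom.toHom hf) (tmul A x m)
  change Hom.toHom (tensorHom (tensorHom f.hom g.hom) (𝟙 Z)) (Hom.toHom (assoc M N Z).inv
      (Hom.toHom (tensorHom (𝟙 M) τ.hom) (Hom.toHom (assoc M Y N).hom
        (tmul B (Hom.toHom σ.hom (tmul A x m)) n)))) =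
    Hom.toHom (assoc M' N' Z).inv (Hom.toHom (tensorHom (𝟙 M') τ'.hom)
      (Hom.toHom (assoc M' Y N').hom
        (tmul B (Hom.toHom σ'.hom (tmul A x (Hom.toHom f.hom m))) (Hom.toHom g.hom n))))
  rw [← hf']
  -- The image of a pure tensor under `σ` need not be pure, but both sides are additive in it, so it
  -- may be replaced by a pure tensor before `τ` is applied. The proofs below repeat this pattern.
  generalize Hom.toHom σ.hom (tmul A x m) = t
  induction t using BalTensor.induction with
  | h0 => simp only [map_zero, BalTensor.zero_tmul]
  | ha t t' ht ht' => simp only [map_add, BalTensor.add_tmul, ht, ht']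
  | ht m y =>
  have hg' : Hom.toHom (tensorHom g.hom (𝟙 Z)) (Hom.toHom τ.hom (tmul B y n)) =
    Hom.toHom τ'.hom (tmul B y (Hom.toHom g.hom n)) :=
      DFunLike.congr_fun (congrArg Hom.toHom hg) (tmul B y n)
  change Hom.toHom (tensorHom (tensorHom f.hom g.hom) (𝟙 Z)) (Hom.toHom (assoc M N Z).inv
      (tmul B m (Hom.toHom τ.hom (tmul B y n)))) =
    Hom.toHom (assoc M' N' Z).inv (tmul B (Hom.toHom f.hom m)
      (Hom.toHom τ'.hom (tmul B y (Hom.toHom g.hom n))))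
  rw [← hg']
  generalize Hom.toHom τ.hom (tmul B y n) = t
  induction t using BalTensor.induction with
  | h0 => simp only [map_zero, BalTensor.tmul_zero]
  | ha t t' ht ht' => simp only [map_add, BalTensor.tmul_add, ht, ht']
  | ht n z => rfl

/-- Both composites apply `σ`, `τ`, `ρ` in turn to move a factor past `M`, `N`, `P`; they differ
only in the bracketing, so the associativity isomorphism intertwines them. -/
theorem hash_assoc (σ : tensor X M ≅ tensor M Y) (τ : tensor Y N ≅ tensor N Z)
    (ρ : tensor Z P ≅ tensor P W) :
    Intertwined (hashIso (hashIso σ τ) ρ) (hashIso σ (hashIso τ ρ)) := by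
  refine ⟨assoc M N P, hom_ext fun t => ?_⟩
  induction t using BalTensor.induction with
  | h0 => simp only [map_zero]
  | ha t t' ht ht' => simp only [map_add, ht, ht']
  | ht x t =>
  induction t using BalTensor.induction₃ with
  | h0 => simp only [BalTensor.tmul_zero, map_zero]
  | ha t t' ht ht' => simp only [map_add, BalTensor.tmul_add, ht, ht']
  | ht m n p =>
  change Hom.toHom (tensorHom (assoc M N P).hom (𝟙 W)) (Hom.toHom (assoc (tensor M N) P W).inv
      (Hom.toHom (tensorHom (𝟙 _) ρ.hom) (Hom.toHom (assoc (tensor M N) Z P).hom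
        (tmul C (Hom.toHom (assoc M N Z).inv (Hom.toHom (tensorHom (𝟙 M) τ.hom)
          (Hom.toHom (assoc M Y N).hom (tmul B (Hom.toHom σ.hom (tmul A x m)) n)))) p)))) =
    Hom.toHom (assoc M (tensor N P) W).inv (Hom.toHom (tensorHom (𝟙 M) (hashIso τ ρ).hom)
      (Hom.toHom (assoc M Y (tensor N P)).hom
        (tmul B (Hom.toHom σ.hom (tmul A x m)) (tmul C n p))))
  generalize Hom.toHom σ.hom (tmul A x m) = t
  induction t using BalTensor.induction with
  | h0 => simp only [map_zero, BalTensor.zero_tmul]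
  | ha t t' ht ht' => simp only [map_add, BalTensor.add_tmul, ht, ht']
  | ht m y =>
  change Hom.toHom (tensorHom (assoc M N P).hom (𝟙 W)) (Hom.toHom (assoc (tensor M N) P W).inv
      (Hom.toHom (tensorHom (𝟙 _) ρ.hom) (Hom.toHom (assoc (tensor M N) Z P).hom
        (tmul C (Hom.toHom (assoc M N Z).inv (tmul B m (Hom.toHom τ.hom (tmul B y n)))) p)))) =
    Hom.toHom (assoc M (tensor N P) W).inv (tmul B m (Hom.toHom (assoc N P W).inv
      (Hom.toHom (tensorHom (𝟙 N) ρ.hom) (Hom.toHom (assoc N Z P).hom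
        (tmul C (Hom.toHom τ.hom (tmul B y n)) p)))))
  generalize Hom.toHom τ.hom (tmul B y n) = t
  induction t using BalTensor.induction with
  | h0 => simp only [map_zero, BalTensor.zero_tmul, BalTensor.tmul_zero]
  | ha t t' ht ht' => simp only [map_add, BalTensor.add_tmul, BalTensor.tmul_add, ht, ht']
  | ht n z =>
  change Hom.toHom (tensorHom (assoc M N P).hom (𝟙 W)) (Hom.toHom (assoc (tensor M N) P W).inv
      (tmul C (tmul B m n) (Hom.toHom ρ.hom (tmul C z p)))) =
    Hom.toHom (assoc M (tensor N P) W).inv (tmul B m (Hom.toHom (assoc N P W).inv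
      (tmul C n (Hom.toHom ρ.hom (tmul C z p)))))
  generalize Hom.toHom ρ.hom (tmul C z p) = t
  induction t using BalTensor.induction with
  | h0 => simp only [map_zero, BalTensor.tmul_zero]
  | ha t t' ht ht' => simp only [map_add, BalTensor.tmul_add, ht, ht']
  | ht p w => rfl

/-- The intertwiner is `σ` itself: on `x ⊗ (x' ⊗ m)` both sides of the square apply `σ` to `x' ⊗ m`
and then move `x` past the `M`-factor of the result by `σ`. -/
theorem slide (σ : tensor X M ≅ tensor M Y) :
    Intertwined (hashIso (Iso.refl (tensor X X)) σ) (hashIso σ (Iso.refl (tensor Y Y))) := by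
  refine ⟨σ, tensor_ext₃ fun x x' m => ?_⟩
  change Hom.toHom (tensorHom σ.hom (𝟙 Y)) (Hom.toHom (assoc X M Y).inv
      (tmul A x (Hom.toHom σ.hom (tmul A x' m)))) =
    Hom.toHom (hashIso σ (Iso.refl (tensor Y Y))).hom (tmul A x (Hom.toHom σ.hom (tmul A x' m)))
  generalize Hom.toHom σ.hom (tmul A x' m) = t
  induction t using BalTensor.induction with
  | h0 => simp only [map_zero, BalTensor.tmul_zero]
  | ha t t' ht ht' => simp only [map_add, BalTensor.tmul_add, ht, ht']
  | ht m y =>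
  change tmul B (Hom.toHom σ.hom (tmul A x m)) y =
    Hom.toHom (assoc M Y Y).inv (Hom.toHom (tensorHom (𝟙 M) (𝟙 (tensor Y Y)))
      (Hom.toHom (assoc M Y Y).hom (tmul B (Hom.toHom σ.hom (tmul A x m)) y)))
  rw [tensorHom_id]
  exact (iso_hom_inv_apply (assoc M Y Y) (tmul B (Hom.toHom σ.hom (tmul A x m)) y)).symm

end Intertwined

/-- This exhibits `nu` as iterated `#`-powers of the identity of `X ⊗ X`, so that no later argument
has to unfold tensor powers. -/
theorem nu_succ (X : Bimodule k A A) (m : ℕ) :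
    nu X (m + 1) = hashIso (nu X m) (Iso.refl (tensor X X)) := by
  refine Iso.ext ?_
  change (assoc X (tpow X m) X).inv ≫ tensorHom (nu X m).hom (𝟙 X) =
    (assoc X (tpow X m) X).inv ≫ tensorHom (nu X m).hom (𝟙 X) ≫ (assoc (tpow X m) X X).hom ≫
      tensorHom (𝟙 (tpow X m)) (𝟙 (tensor X X)) ≫ (assoc (tpow X m) X X).inv
  rw [tensorHom_id, Category.id_comp, Iso.hom_inv_id, Category.comp_id]

-- Each of the `m + 1` identity factors of `nu X m` is moved past `σ` by `slide`.
open Intertwined in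
theorem slide_nu {X : Bimodule k A A} {Y : Bimodule k B B} {M : Bimodule k A B}
    (σ : tensor X M ≅ tensor M Y) (m : ℕ) :
    Intertwined (hashIso (nu X m) σ) (hashIso σ (nu Y m)) := by
  induction m with
  | zero => exact slide σ
  | succ m ih =>
    rw [nu_succ, nu_succ]
    exact (hash_assoc _ _ _).trans <| ((Intertwined.refl _).hash (slide σ)).trans <|
      (hash_assoc _ _ _).symm.trans <| (ih.hash (Intertwined.refl _)).trans (hash_assoc _ _ _)

/-- There are `M`, `N` and `n = m + 1` with isomorphisms `X ⊗ M ≅ M ⊗ Y` and `Y ⊗ N ≅ N ⊗ X` under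
which `M ⊗ N` and `N ⊗ M` become the `n`-th tensor powers of `X` and `Y`. -/
def ShiftEquivalent (X : Bimodule k A A) (Y : Bimodule k B B) (m : ℕ) : Prop :=
  ∃ (M : Bimodule k A B) (N : Bimodule k B A) (σ : tensor X M ≅ tensor M Y)
    (τ : tensor Y N ≅ tensor N X),
    Intertwined (hashIso σ τ) (nu X m) ∧ Intertwined (hashIso τ σ) (nu Y m)

-- In `M ⊗ M' ⊗ N' ⊗ N` the middle pair contracts to the identity of `Y ⊗ Y`, which slides past `τ`;
-- the outer pair then gives `nu X m`. In `N' ⊗ N ⊗ M ⊗ M'` the middle pair contracts to `nu Y m`,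
-- which slides past `σ'`. Lag one for the second equivalence suffices, since a chain grows by one
-- elementary step at a time.
open Intertwined in
theorem ShiftEquivalent.trans {X : Bimodule k A A} {Y : Bimodule k B B} {Z : Bimodule k C C}
    {m : ℕ} (h : ShiftEquivalent X Y m) (h' : ShiftEquivalent Y Z 0) :
    ShiftEquivalent X Z (m + 1) := by
  obtain ⟨M, N, σ, τ, h₁, h₂⟩ := h
  obtain ⟨M', N', σ', τ', h₁', h₂'⟩ := h'
  refine ⟨tensor M M', tensor N' N, hashIso σ σ', hashIso τ' τ, ?_, ?_⟩
  · rw [nu_succ]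
    exact (hash_assoc _ _ _).trans <|
      ((Intertwined.refl σ).hash ((hash_assoc _ _ _).symm.trans (h₁'.hash (Intertwined.refl τ)))).trans <|
      ((Intertwined.refl σ).hash (slide τ)).trans <| (hash_assoc _ _ _).symm.trans (h₁.hash (Intertwined.refl _))
  · rw [nu_succ]
    exact (hash_assoc _ _ _).trans <|
      ((Intertwined.refl τ').hash ((hash_assoc _ _ _).symm.trans (h₂.hash (Intertwined.refl σ')))).trans <|
      ((Intertwined.refl τ').hash (slide_nu σ' m)).trans <| (hash_assoc _ _ _).symm.trans <|
      -- What remains is `nu Z 0 # nu Z m`, with the factors of `nu Z (m + 1)` in the wrong order.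
      -- As `nu Z 0` is an identity, `slide` exchanges them.
      (h₂'.hash (Intertwined.refl _)).trans (slide (nu Z m))

end Bimodule

/-! ### Factorizations of graphs -/

/-- A factorization of the adjacency matrices of `E` and `F` as `R S` and `S R` on the level of
edges: a bipartite graph with vertices `E⁰ ⊔ F⁰`, and bijections of the edges of `E` and of `F` with
the paths of length two which begin in `E⁰` and in `F⁰`. -/
structure Factorization (E F : FiniteGraph.{u}) where
  R : Type u
  S : Type u
  [fintypeR : Fintype R]
  [fintypeS : Fintype S]
  sR : R → E.Vert
  rR : R → F.Vert
  sS : S → F.Vert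
  rS : S → E.Vert
  edgeE : {p : R × S // rR p.1 = sS p.2} ≃ E.Edge
  s_edgeE : ∀ p, E.s (edgeE p) = sR p.1.1
  r_edgeE : ∀ p, E.r (edgeE p) = rS p.1.2
  edgeF : {p : S × R // rS p.1 = sR p.2} ≃ F.Edge
  s_edgeF : ∀ p, F.s (edgeF p) = sS p.1.1
  r_edgeF : ∀ p, F.r (edgeF p) = rR p.1.2

namespace Factorization

attribute [instance] Factorization.fintypeR Factorization.fintypeS

/-- Exchange of the roles of the two graphs. -/
abbrev swap {E F : FiniteGraph.{u}} (d : Factorization E F) : Factorization F E where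
  R := d.S
  S := d.R
  sR := d.sS
  rR := d.rS
  sS := d.sR
  rS := d.rR
  edgeE := d.edgeF
  s_edgeE := d.s_edgeF
  r_edgeE := d.r_edgeF
  edgeF := d.edgeE
  s_edgeF := d.s_edgeE
  r_edgeF := d.r_edgeE

end Factorization

/-! ### Bimodules spanned by the edges of bipartite graphs -/

/-- The vector space with basis the finite set `T` of edges with sources in `V` and ranges in
`W`. -/
def SpanSpace (k : Type u) {V W T : Type u} (_ : T → V) (_ : T → W) : Type u := T → k

section SpanSpace

variable (k : Type u) [Field k] {V W T : Type u} (s : T → V) (r : T → W)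

instance : AddCommGroup (SpanSpace k s r) := inferInstanceAs (AddCommGroup (T → k))

instance : Module (V → k) (SpanSpace k s r) where
  smul a x := fun t => a (s t) * x t
  one_smul _ := funext fun _ => one_mul _
  mul_smul _ _ _ := funext fun _ => mul_assoc _ _ _
  smul_zero _ := funext fun _ => mul_zero _
  smul_add _ _ _ := funext fun _ => mul_add _ _ _
  add_smul _ _ _ := funext fun _ => add_mul _ _ _
  zero_smul _ := funext fun _ => zero_mul _

instance : Module (W → k)ᵐᵒᵖ (SpanSpace k s r) where
  smul b x := fun t => x t * b.unop (r t)
  one_smul _ := funext fun _ => mul_one _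
  mul_smul _ _ _ := funext fun _ => (mul_assoc _ _ _).symm
  smul_zero _ := funext fun _ => zero_mul _
  smul_add _ _ _ := funext fun _ => add_mul _ _ _
  add_smul _ _ _ := funext fun _ => mul_add _ _ _
  zero_smul _ := funext fun _ => mul_zero _

/-- The bimodule with basis `T`, where `v · t · w = t` if `v = s(t)` and `w = r(t)`, and
`v · t · w = 0` otherwise. -/
abbrev spanBimodule : Bimodule k (V → k) (W → k) where
  carrier := SpanSpace k s r
  comm := ⟨fun a b x => funext fun t => (mul_assoc (a (s t)) (x t) (b.unop (r t))).symm⟩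
  central c x := funext fun t => mul_comm c (x t)

variable {k}

open scoped Classical in
/-- The multiple `c t` of the basis vector `t`. -/
noncomputable def spanSingle (t : T) : k →+ SpanSpace k s r := AddMonoidHom.single (fun _ => k) t

variable {s r}

open scoped Classical in
theorem spanSingle_apply (t t' : T) (c : k) :
    spanSingle s r t c t' = if t' = t then c else 0 := by
  exact Pi.single_apply (M := k) t c t'

theorem left_smul_spanSingle (a : V → k) (t : T) (c : k) :
    a • spanSingle s r t c = spanSingle s r t (a (s t) * c) := by
  funext t'
  change a (s t') * spanSingle s r t c t' = _
  simp only [spanSingle_apply]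
  split_ifs with h
  · rw [h]
  · exact mul_zero _

theorem right_smul_spanSingle (b : (W → k)ᵐᵒᵖ) (t : T) (c : k) :
    b • spanSingle s r t c = spanSingle s r t (c * b.unop (r t)) := by
  funext t'
  change spanSingle s r t c t' * b.unop (r t') = _
  simp only [spanSingle_apply]
  split_ifs with h
  · rw [h]
  · exact zero_mul _

theorem sum_spanSingle [Fintype T] (x : SpanSpace k s r) : ∑ t, spanSingle s r t (x t) = x := by
  classical
  exact (Finset.univ_sum_single (M := fun _ => k) x)

end SpanSpace

namespace Factorization

open BalTensor Bimodule

variable (k : Type u) [Field k] {E F : FiniteGraph.{u}} (d : Factorization E F)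

/-- The map `a ⊗ b ↦ ab`, where `a ∈ R` and `b ∈ S`, and `ab` is the edge of `E` which is given by
`a` and `b` if they are composable, and zero otherwise. -/
def mulHom : tensor (spanBimodule k d.sR d.rR) (spanBimodule k d.sS d.rS) ⟶ edgeBimodule k E where
  toHom := BalTensor.lift
    (fun (x : SpanSpace k d.sR d.rR) (y : SpanSpace k d.sS d.rS) =>
      (fun e => x (d.edgeE.symm e).1.1 * y (d.edgeE.symm e).1.2 : EdgeSpace k E))
    (fun x x' y => funext fun e => add_mul _ _ _) (fun x y y' => funext fun e => mul_add _ _ _)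
    (fun b x y => funext fun e => by
      change x _ * b (d.rR _) * y _ = x _ * (b (d.sS _) * y _)
      rw [(d.edgeE.symm e).2, mul_assoc])
  map_left a t := by
    induction t using BalTensor.induction with
    | h0 => simp only [smul_zero, map_zero]
    | ha t t' h h' => simp only [smul_add, map_add, h, h']
    | ht x y =>
      refine funext fun e => ?_
      change a (d.sR _) * x _ * y _ = a (E.s e) * (x _ * y _)
      rw [← d.s_edgeE, Equiv.apply_symm_apply, mul_assoc]
  map_right b t := by
    induction t using BalTensor.induction with
    | h0 => simp only [smul_zero, map_zero]
    | ha t t' h h' => simp only [smul_add, map_add, h, h']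
    | ht x y =>
      refine funext fun e => ?_
      change x _ * (y _ * b.unop (d.rS _)) = x _ * y _ * b.unop (E.r e)
      rw [← d.r_edgeE, Equiv.apply_symm_apply, mul_assoc]

/-- The inverse of `mulHom`. -/
noncomputable def mulInv :
    EdgeSpace k E →+ BalTensor (VertexAlg k F) (SpanSpace k d.sR d.rR) (SpanSpace k d.sS d.rS) :=
  AddMonoidHom.mk' (fun x => ∑ e, tmul (VertexAlg k F)
      (spanSingle d.sR d.rR (d.edgeE.symm e).1.1 (x e))
      (spanSingle d.sS d.rS (d.edgeE.symm e).1.2 (1 : k)))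
    fun x y => by
      rw [← Finset.sum_add_distrib]
      refine Finset.sum_congr rfl fun e _ => ?_
      rw [← BalTensor.add_tmul, ← map_add]
      rfl

open scoped Classical in
theorem mulHom_single_tmul_single (a : d.R) (b : d.S) (c c' : k) (e : E.Edge) :
    (mulHom k d).toHom (tmul (VertexAlg k F) (spanSingle d.sR d.rR a c)
      (spanSingle d.sS d.rS b c')) e = if (d.edgeE.symm e).1 = (a, b) then c * c' else 0 := by
  change spanSingle d.sR d.rR a c (d.edgeE.symm e).1.1 *
    spanSingle d.sS d.rS b c' (d.edgeE.symm e).1.2 = _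
  simp only [spanSingle_apply, Prod.ext_iff]
  split_ifs <;> simp_all

theorem single_tmul_single (a : d.R) (b : d.S) (c c' : k) :
    tmul (VertexAlg k F) (spanSingle d.sR d.rR a c) (spanSingle d.sS d.rS b c') =
      tmul (VertexAlg k F) (spanSingle d.sR d.rR a (c * c')) (spanSingle d.sS d.rS b 1) := by
  -- The constant function `c'` is the scalar `c'` of the vertex algebra, so it may cross the tensor
  -- sign.
  have h := BalTensor.smul_tmul (B := VertexAlg k F) (fun _ => c')
    (spanSingle d.sR d.rR a c) (spanSingle d.sS d.rS b (1 : k))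
  rw [right_smul_spanSingle, left_smul_spanSingle, mul_one] at h
  exact h.symm

/-- The vertex `r(a)` fixes `a` from the right and kills `b` from the left. Hence only composable
pairs, that is edges of `E`, survive in the tensor product. -/
theorem single_tmul_single_eq_zero {a : d.R} {b : d.S} (h : d.rR a ≠ d.sS b) (c c' : k) :
    tmul (VertexAlg k F) (spanSingle d.sR d.rR a c) (spanSingle d.sS d.rS b c') = 0 := by
  classical
  have h' := BalTensor.smul_tmul (B := VertexAlg k F) (Pi.single (d.rR a) 1)
    (spanSingle d.sR d.rR a c) (spanSingle d.sS d.rS b c')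
  rw [right_smul_spanSingle, left_smul_spanSingle, unop_op, Pi.single_eq_same,
    Pi.single_eq_of_ne h.symm, zero_mul, map_zero, mul_one] at h'
  rw [h', BalTensor.tmul_zero]

theorem mulInv_mulHom_single (a : d.R) (b : d.S) (c c' : k) :
    mulInv k d ((mulHom k d).toHom (tmul (VertexAlg k F) (spanSingle d.sR d.rR a c)
      (spanSingle d.sS d.rS b c'))) =
    tmul (VertexAlg k F) (spanSingle d.sR d.rR a c) (spanSingle d.sS d.rS b c') := by
  classical
  change ∑ e, tmul (VertexAlg k F) (spanSingle d.sR d.rR (d.edgeE.symm e).1.1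
    ((mulHom k d).toHom (tmul (VertexAlg k F) (spanSingle d.sR d.rR a c)
      (spanSingle d.sS d.rS b c')) e)) (spanSingle d.sS d.rS (d.edgeE.symm e).1.2 (1 : k)) = _
  simp_rw [mulHom_single_tmul_single k d a b c c']
  by_cases hab : d.rR a = d.sS b
  · rw [Finset.sum_eq_single (d.edgeE ⟨(a, b), hab⟩)]
    · rw [Equiv.symm_apply_apply, if_pos rfl, ← single_tmul_single]
    · intro e _ he
      rw [if_neg, map_zero, BalTensor.zero_tmul]
      exact fun h => he ((Equiv.symm_apply_eq _).1 (Subtype.ext h))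
    · simp
  · rw [single_tmul_single_eq_zero k d hab]
    refine Finset.sum_eq_zero fun e _ => ?_
    rw [if_neg, map_zero, BalTensor.zero_tmul]
    intro h
    have := (d.edgeE.symm e).2
    rw [h] at this
    exact hab this

theorem mulInv_mulHom (t) : mulInv k d ((mulHom k d).toHom t) = t := by
  induction t using BalTensor.induction with
  | h0 => simp only [map_zero]
  | ha t t' h h' => simp only [map_add, h, h']
  | ht x y =>
    rw [← sum_spanSingle x, ← sum_spanSingle y, BalTensor.sum_tmul]
    simp only [BalTensor.tmul_sum, map_sum]
    exact Finset.sum_congr rfl fun a _ => Finset.sum_congr rfl fun b _ =>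
      mulInv_mulHom_single k d a b _ _

theorem mulHom_mulInv (x : EdgeSpace k E) : (mulHom k d).toHom (mulInv k d x) = x := by
  classical
  funext e
  change (mulHom k d).toHom (∑ e, tmul (VertexAlg k F)
      (spanSingle d.sR d.rR (d.edgeE.symm e).1.1 (x e))
      (spanSingle d.sS d.rS (d.edgeE.symm e).1.2 (1 : k))) e = x e
  rw [map_sum]
  have key : ∀ (f : E.Edge → EdgeSpace k E), (∑ e', f e') e = ∑ e', f e' e := fun f =>
    Finset.sum_apply (M := fun _ => k) e _ f
  refine (key _).trans ?_
  rw [Finset.sum_eq_single e]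
  · exact (mulHom_single_tmul_single k d _ _ _ _ _).trans ((if_pos rfl).trans (mul_one _))
  · intro e' _ he
    exact (mulHom_single_tmul_single k d _ _ _ _ _).trans
      (if_neg fun h => he (d.edgeE.symm.injective (Subtype.ext h)).symm)
  · simp

/-- The isomorphism `M ⊗ N ≅ kE¹`, for the bimodules `M` and `N` with the bases `R` and `S`. -/
noncomputable def mulIso : tensor (spanBimodule k d.sR d.rR) (spanBimodule k d.sS d.rS) ≅ edgeBimodule k E where
  hom := mulHom k d
  inv :=
    { toHom := mulInv k d
      map_left a x := by
        -- The inverse of a bijective bimodule homomorphism is again one; linearity is inherited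
        -- from `mulHom`.
        conv_lhs => rw [← mulHom_mulInv k d x, ← (mulHom k d).map_left]
        exact mulInv_mulHom k d _
      map_right b x := by
        conv_lhs => rw [← mulHom_mulInv k d x, ← (mulHom k d).map_right]
        exact mulInv_mulHom k d _ }
  hom_inv_id := hom_ext (mulInv_mulHom k d)
  inv_hom_id := hom_ext (mulHom_mulInv k d)

end Factorization

/-! ### The shift equivalence of an elementary step. -/

namespace Bimodule

open BalTensor

variable {k A B : Type u} [Field k] [Ring A] [Algebra k A] [Ring B] [Algebra k B]
  {X : Bimodule k A A} {Y : Bimodule k B B} {M : Bimodule k A B} {N : Bimodule k B A}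

/-- The isomorphism `X ⊗ M ≅ (M ⊗ N) ⊗ M ≅ M ⊗ (N ⊗ M) ≅ M ⊗ Y`. -/
def exchangeIso (f : tensor M N ≅ X) (g : tensor N M ≅ Y) : tensor X M ≅ tensor M Y :=
  tensorIso f.symm (Iso.refl M) ≪≫ assoc M N M ≪≫ tensorIso (Iso.refl M) g

/-- Write `x = f(m' ⊗ n')`. Then `f⁻¹` cancels `f` and `g⁻¹` cancels `g`, and the composite only
rebrackets `m' ⊗ n' ⊗ m ⊗ n`, ending in `f(m' ⊗ n') ⊗ f(m ⊗ n)` once `f` is applied. So `f` is the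
intertwiner. -/
theorem intertwined_exchangeIso (f : tensor M N ≅ X) (g : tensor N M ≅ Y) :
    Intertwined (hashIso (exchangeIso f g) (exchangeIso g f)) (Iso.refl (tensor X X)) := by
  refine ⟨f, tensor_ext₃ fun x m n => ?_⟩
  obtain ⟨t, rfl⟩ : ∃ t, f.hom.toHom t = x := ⟨f.inv.toHom x, iso_inv_hom_apply f x⟩
  change Hom.toHom (tensorHom f.hom (𝟙 X)) (Hom.toHom (assoc M N X).inv
    (Hom.toHom (tensorHom (𝟙 M) (exchangeIso g f).hom) (Hom.toHom (assoc M Y N).hom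
      (tmul B (Hom.toHom (tensorHom (𝟙 M) g.hom) (Hom.toHom (assoc M N M).hom
        (tmul A (Hom.toHom f.inv (Hom.toHom f.hom t)) m))) n)))) =
    tmul A (Hom.toHom f.hom t) (Hom.toHom f.hom (tmul B m n))
  rw [iso_hom_inv_apply]
  induction t using BalTensor.induction with
  | h0 => simp only [map_zero, BalTensor.zero_tmul]
  | ha t t' h h' => simp only [map_add, BalTensor.add_tmul, h, h']
  | ht m' n' =>
    change Hom.toHom (tensorHom f.hom (𝟙 X)) (Hom.toHom (assoc M N X).inv (tmul B m'
      (Hom.toHom (tensorHom (𝟙 N) f.hom) (Hom.toHom (assoc N M N).hom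
        (tmul B (Hom.toHom g.inv (Hom.toHom g.hom (tmul A n' m))) n))))) = _
    rw [iso_hom_inv_apply]
    rfl

end Bimodule

open Bimodule in
theorem Factorization.shiftEquivalent (k : Type u) [Field k] {E F : FiniteGraph.{u}}
    (d : Factorization E F) : ShiftEquivalent (edgeBimodule k E) (edgeBimodule k F) 0 :=
  ⟨spanBimodule k d.sR d.rR, spanBimodule k d.sS d.rS, exchangeIso (d.mulIso k) (d.swap.mulIso k),
    exchangeIso (d.swap.mulIso k) (d.mulIso k), intertwined_exchangeIso _ _,
    intertwined_exchangeIso _ _⟩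

open Bimodule in
theorem CompatibleModuleShiftEquivalent.of_shiftEquivalent {k : Type u} [Field k]
    {E F : FiniteGraph.{u}} {m : ℕ}
    (h : ShiftEquivalent (edgeBimodule k E) (edgeBimodule k F) m) :
    CompatibleModuleShiftEquivalent k E F := by
  obtain ⟨M, N, σ, τ, ⟨f, hf⟩, ⟨g, hg⟩⟩ := h
  exact ⟨M, N, m, f, g, σ, τ, hf, hg⟩

/-! ### Relations in Leavitt path algebras -/

namespace Leavitt

open LeavittGen

variable (k : Type u) [Field k] (E : FiniteGraph.{u})

theorem sum_vert : ∑ v, of k E (vert v) = 1 := by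
  have := RingQuot.mkAlgHom_rel k (LeavittRel.one (k := k) (E := E))
  rwa [map_sum, map_one] at this

open scoped Classical in
theorem vert_mul_vert (v w : E.Vert) :
    of k E (vert v) * of k E (vert w) = if v = w then of k E (vert v) else 0 := by
  have := RingQuot.mkAlgHom_rel k (LeavittRel.vert_mul (k := k) v w)
  rwa [map_mul, apply_ite (RingQuot.mkAlgHom k (LeavittRel k E)), map_zero] at this

theorem vert_mul_self (v : E.Vert) : of k E (vert v) * of k E (vert v) = of k E (vert v) := by
  rw [vert_mul_vert, if_pos rfl]

theorem source_mul_edge (e : E.Edge) :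
    of k E (vert (E.s e)) * of k E (edge e) = of k E (edge e) := by
  have := RingQuot.mkAlgHom_rel k (LeavittRel.source_edge (k := k) e)
  rwa [map_mul] at this

theorem edge_mul_range (e : E.Edge) :
    of k E (edge e) * of k E (vert (E.r e)) = of k E (edge e) := by
  have := RingQuot.mkAlgHom_rel k (LeavittRel.edge_range (k := k) e)
  rwa [map_mul] at this

theorem range_mul_ghost (e : E.Edge) :
    of k E (vert (E.r e)) * of k E (ghost e) = of k E (ghost e) := by
  have := RingQuot.mkAlgHom_rel k (LeavittRel.range_ghost (k := k) e)
  rwa [map_mul] at this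

theorem ghost_mul_source (e : E.Edge) :
    of k E (ghost e) * of k E (vert (E.s e)) = of k E (ghost e) := by
  have := RingQuot.mkAlgHom_rel k (LeavittRel.ghost_source (k := k) e)
  rwa [map_mul] at this

open scoped Classical in
theorem ghost_mul_edge (e f : E.Edge) :
    of k E (ghost e) * of k E (edge f) = if e = f then of k E (vert (E.r e)) else 0 := by
  have := RingQuot.mkAlgHom_rel k (LeavittRel.ck1 (k := k) e f)
  rwa [map_mul, apply_ite (RingQuot.mkAlgHom k (LeavittRel k E)), map_zero] at this

open scoped Classical in
theorem sum_edge_mul_ghost {E : FiniteGraph.{u}} (hE : E.NoSinks) (v : E.Vert) :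
    ∑ e, (if E.s e = v then of k E (edge e) * of k E (ghost e) else 0) = of k E (vert v) := by
  have := RingQuot.mkAlgHom_rel k (LeavittRel.ck2 (k := k) v (hE v))
  rw [map_sum, Finset.sum_filter] at this
  simp only [map_mul] at this
  exact this.symm

open scoped Classical in
theorem vert_mul_edge (v : E.Vert) (e : E.Edge) :
    of k E (vert v) * of k E (edge e) = if v = E.s e then of k E (edge e) else 0 := by
  rw [← source_mul_edge, ← mul_assoc, vert_mul_vert]
  split_ifs with h
  · rw [h]
  · rw [zero_mul]

variable {k E}

/-- An additive map between right modules over a Leavitt path algebra is linear if it commutes with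
the scalars of `k` and the generators. -/
theorem map_op_smul {M N : Type u} [AddCommGroup M] [AddCommGroup N] [Module (Leavitt k E)ᵐᵒᵖ M]
    [Module (Leavitt k E)ᵐᵒᵖ N] (f : M →+ N)
    (hk : ∀ (c : k) m, f (op (algebraMap k (Leavitt k E) c) • m) =
      op (algebraMap k (Leavitt k E) c) • f m)
    (hg : ∀ (x : LeavittGen E) m, f (op (of k E x) • m) = op (of k E x) • f m)
    (r : (Leavitt k E)ᵐᵒᵖ) (m : M) : f (r • m) = r • f m := by
  induction r using MulOpposite.rec' with | _ r => ?_
  obtain ⟨y, rfl⟩ := RingQuot.mkAlgHom_surjective k (LeavittRel k E) r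
  induction y using FreeAlgebra.induction generalizing m with
  | grade0 c => rw [AlgHom.commutes]; exact hk c m
  | grade1 x => exact hg x m
  | mul a b ha hb => rw [map_mul, op_mul, mul_smul, mul_smul, hb, ha]
  | add a b ha hb => rw [map_add, MulOpposite.op_add, add_smul, add_smul, map_add, ha, hb]

end Leavitt

/-! ### Transfer of modules along a factorization -/

namespace Factorization

open Leavitt LeavittGen

variable (k : Type u) [Field k] {E F : FiniteGraph.{u}} (d : Factorization E F)

open scoped Classical in
/-- The edge `ab` of `E` in the Leavitt path algebra; zero if `a` and `b` are not composable. -/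
noncomputable def word (a : d.R) (b : d.S) : Leavitt k E :=
  if h : d.rR a = d.sS b then of k E (edge (d.edgeE ⟨(a, b), h⟩)) else 0

open scoped Classical in
/-- The ghost edge `(ab)*` of `E` in the Leavitt path algebra; zero if `a` and `b` are not
composable. -/
noncomputable def ghostWord (a : d.R) (b : d.S) : Leavitt k E :=
  if h : d.rR a = d.sS b then of k E (ghost (d.edgeE ⟨(a, b), h⟩)) else 0

variable {d} in
theorem word_eq_zero {a : d.R} {b : d.S} (h : d.rR a ≠ d.sS b) : d.word k a b = 0 := dif_neg h

variable {d} in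
theorem ghostWord_eq_zero {a : d.R} {b : d.S} (h : d.rR a ≠ d.sS b) : d.ghostWord k a b = 0 :=
  dif_neg h

theorem word_edgeE_symm (e : E.Edge) :
    d.word k (d.edgeE.symm e).1.1 (d.edgeE.symm e).1.2 = of k E (edge e) := by
  rw [word, dif_pos (d.edgeE.symm e).2]
  exact congrArg (fun e => of k E (edge e)) (d.edgeE.apply_symm_apply e)

theorem ghostWord_edgeE_symm (e : E.Edge) :
    d.ghostWord k (d.edgeE.symm e).1.1 (d.edgeE.symm e).1.2 = of k E (ghost e) := by
  rw [ghostWord, dif_pos (d.edgeE.symm e).2]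
  exact congrArg (fun e => of k E (ghost e)) (d.edgeE.apply_symm_apply e)

open scoped Classical in
theorem vert_mul_word (v : E.Vert) (a : d.R) (b : d.S) :
    of k E (vert v) * d.word k a b = if v = d.sR a then d.word k a b else 0 := by
  by_cases h : d.rR a = d.sS b
  · rw [word, dif_pos h, vert_mul_edge, d.s_edgeE]
  · rw [word_eq_zero k h, mul_zero, ite_self]

theorem word_mul_vert (a : d.R) (b : d.S) :
    d.word k a b * of k E (vert (d.rS b)) = d.word k a b := by
  by_cases h : d.rR a = d.sS b
  · rw [word, dif_pos h]
    have := edge_mul_range k E (d.edgeE ⟨(a, b), h⟩)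
    rwa [d.r_edgeE] at this
  · rw [word_eq_zero k h, zero_mul]

theorem ghostWord_mul_vert (a : d.R) (b : d.S) :
    d.ghostWord k a b * of k E (vert (d.sR a)) = d.ghostWord k a b := by
  by_cases h : d.rR a = d.sS b
  · rw [ghostWord, dif_pos h]
    have := ghost_mul_source k E (d.edgeE ⟨(a, b), h⟩)
    rwa [d.s_edgeE] at this
  · rw [ghostWord_eq_zero k h, zero_mul]

open scoped Classical in
theorem ghostWord_mul_word (a a' : d.R) (b b' : d.S) :
    d.ghostWord k a b * d.word k a' b' =
      if a = a' ∧ b = b' ∧ d.rR a = d.sS b then of k E (vert (d.rS b)) else 0 := by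
  by_cases h : d.rR a = d.sS b
  · by_cases h' : d.rR a' = d.sS b'
    · rw [ghostWord, dif_pos h, word, dif_pos h', ghost_mul_edge, d.r_edgeE]
      refine if_congr ?_ rfl rfl
      rw [d.edgeE.apply_eq_iff_eq, Subtype.mk.injEq, Prod.mk.injEq]
      tauto
    · rw [word_eq_zero k h', mul_zero, if_neg]
      rintro ⟨rfl, rfl, -⟩
      exact h' h
  · rw [ghostWord_eq_zero k h, zero_mul, if_neg fun h' => h h'.2.2]

-- This is (CK2) rewritten for pairs. The sum may run over all pairs, since words of pairs that are
-- not composable vanish.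
open scoped Classical in
theorem sum_word_mul_ghostWord (hE : E.NoSinks) (v : E.Vert) :
    ∑ a, ∑ b, (if d.sR a = v then d.word k a b * d.ghostWord k a b else 0) =
      of k E (vert v) := by
  rw [← sum_edge_mul_ghost k hE, ← Fintype.sum_prod_type']
  symm
  refine Fintype.sum_of_injective (fun e => (d.edgeE.symm e).1)
    (Subtype.val_injective.comp d.edgeE.symm.injective) _ _ (fun p hp => ?_) fun e => ?_
  · rw [word_eq_zero, zero_mul, ite_self]
    exact fun h => hp ⟨d.edgeE ⟨p, h⟩, by simp⟩
  · rw [word_edgeE_symm, ghostWord_edgeE_symm, ← d.s_edgeE, Equiv.apply_symm_apply]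

/-- The functions `n : S → M` with `n(b) = n(b) r(b)` for all `b`. -/
def transferSubgroup (M : Type u) [AddCommGroup M] [Module (Leavitt k E)ᵐᵒᵖ M] :
    AddSubgroup (d.S → M) where
  carrier := {n | ∀ b, op (of k E (vert (d.rS b))) • n b = n b}
  zero_mem' b := smul_zero _
  add_mem' hm hn b := by rw [Pi.add_apply, smul_add, hm, hn]
  neg_mem' hn b := by rw [Pi.neg_apply, smul_neg, hn]

/-- The right `L_k(F)`-module which belongs to a right `L_k(E)`-module `M`. It consists of the
functions `n : S → M` with `n(b) = n(b) r(b)` for all `b`. -/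
def Transfer (_ : E.NoSinks) (M : Type u) [AddCommGroup M] [Module (Leavitt k E)ᵐᵒᵖ M] : Type u :=
  d.transferSubgroup k M

/-! ### The action of `L_k(F)` on transferred modules, and their gradings. -/

namespace Transfer

variable {k d} {hE : E.NoSinks} {M : Type u} [AddCommGroup M] [Module (Leavitt k E)ᵐᵒᵖ M]

instance : AddCommGroup (d.Transfer k hE M) :=
  inferInstanceAs (AddCommGroup (d.transferSubgroup k M))

/-- The value of an element at `b`. -/
def eval (b : d.S) : d.Transfer k hE M →+ M :=
  (Pi.evalAddMonoidHom (fun _ => M) b).comp (d.transferSubgroup k M).subtype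

@[ext]
theorem ext {n n' : d.Transfer k hE M} (h : ∀ b, eval b n = eval b n') : n = n' :=
  Subtype.ext (funext h)

theorem vert_smul_eval (b : d.S) (n : d.Transfer k hE M) :
    op (of k E (vert (d.rS b))) • eval b n = eval b n := n.2 b

instance : Module k (d.Transfer k hE M) where
  smul c n := ⟨fun b => op (algebraMap k (Leavitt k E) c) • eval b n, fun b => by
    rw [smul_smul, ← op_mul, Algebra.commutes, op_mul, mul_smul, vert_smul_eval]⟩
  one_smul n := ext fun b => by
    change op (algebraMap k (Leavitt k E) 1) • eval b n = _
    rw [map_one, op_one, one_smul]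
  mul_smul c c' n := ext fun b => by
    change op (algebraMap k (Leavitt k E) (c * c')) • eval b n =
      op (algebraMap k (Leavitt k E) c) • op (algebraMap k (Leavitt k E) c') • eval b n
    rw [mul_comm, map_mul, op_mul, mul_smul]
  smul_zero c := ext fun b => smul_zero (op (algebraMap k (Leavitt k E) c))
  smul_add c n n' := ext fun b => smul_add (op (algebraMap k (Leavitt k E) c)) _ _
  add_smul c c' n := ext fun b => by
    change op (algebraMap k (Leavitt k E) (c + c')) • eval b n =
      op (algebraMap k (Leavitt k E) c) • eval b n + op (algebraMap k (Leavitt k E) c') • eval b n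
    rw [map_add, MulOpposite.op_add, add_smul]
  zero_smul n := ext fun b => by
    change op (algebraMap k (Leavitt k E) 0) • eval b n = 0
    rw [map_zero, op_zero, zero_smul]

theorem eval_smul (b : d.S) (c : k) (n : d.Transfer k hE M) :
    eval b (c • n) = op (algebraMap k (Leavitt k E) c) • eval b n := rfl

theorem smul_algebraMap_comm (x : Leavitt k E) (c : k) (m : M) :
    op x • op (algebraMap k (Leavitt k E) c) • m =
      op (algebraMap k (Leavitt k E) c) • op x • m := by
  rw [smul_smul, smul_smul, ← op_mul, ← op_mul, Algebra.commutes]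

open scoped Classical in
/-- The action of a vertex of `F`. -/
noncomputable def vertEnd (hE : E.NoSinks) (M : Type u) [AddCommGroup M]
    [Module (Leavitt k E)ᵐᵒᵖ M] (w : F.Vert) : Module.End k (d.Transfer k hE M) where
  toFun n := ⟨fun b => if d.sS b = w then eval b n else 0, fun b => by
    beta_reduce
    split_ifs
    · exact vert_smul_eval b n
    · exact smul_zero _⟩
  map_add' n n' := ext fun b => by
    change ite _ (eval b n + eval b n') 0 = ite _ (eval b n) 0 + ite _ (eval b n') 0
    split_ifs
    · rfl
    · exact (add_zero _).symm
  map_smul' c n := ext fun b => by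
    change ite _ (op (algebraMap k (Leavitt k E) c) • eval b n) 0 =
      op (algebraMap k (Leavitt k E) c) • ite _ (eval b n) 0
    rw [smul_ite, smul_zero]

open scoped Classical in
theorem eval_vertEnd (w : F.Vert) (n : d.Transfer k hE M) (b : d.S) :
    eval b (vertEnd hE M w n) = if d.sS b = w then eval b n else 0 := rfl

/-- The action of an edge of `F`. -/
noncomputable def edgeEnd (hE : E.NoSinks) (M : Type u) [AddCommGroup M]
    [Module (Leavitt k E)ᵐᵒᵖ M] (f : F.Edge) : Module.End k (d.Transfer k hE M) where
  -- Think of `n` as `∑ n(b) b*` and let `f = b₀ a`. By (CK1) the product with `f` is `n(b₀) a`,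
  -- which (CK2) expands to `∑ n(b₀)(ab) b*`.
  toFun n := ⟨fun b => op (d.word k (d.edgeF.symm f).1.2 b) • eval (d.edgeF.symm f).1.1 n,
    fun b => by rw [smul_smul, ← op_mul, word_mul_vert]⟩
  map_add' n n' := ext fun b => smul_add (op (d.word k _ b)) (eval _ n) (eval _ n')
  map_smul' c n := ext fun b => smul_algebraMap_comm (d.word k _ b) c (eval _ n)

theorem eval_edgeEnd (f : F.Edge) (n : d.Transfer k hE M) (b : d.S) :
    eval b (edgeEnd hE M f n) =
      op (d.word k (d.edgeF.symm f).1.2 b) • eval (d.edgeF.symm f).1.1 n := rfl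

open scoped Classical in
/-- The action of a ghost edge of `F`. -/
noncomputable def ghostEnd (hE : E.NoSinks) (M : Type u) [AddCommGroup M]
    [Module (Leavitt k E)ᵐᵒᵖ M] (f : F.Edge) : Module.End k (d.Transfer k hE M) where
  -- For `f = b₀ a` the product of `∑ n(b') b'*` with `f* = a* b₀*` is `∑ n(b') (ab')* b₀*`, which
  -- has a coefficient only at `b₀`.
  toFun n := ⟨fun b => if b = (d.edgeF.symm f).1.1 then
      ∑ b', op (d.ghostWord k (d.edgeF.symm f).1.2 b') • eval b' n else 0, fun b => by
    beta_reduce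
    split_ifs with h
    · rw [Finset.smul_sum]
      refine Finset.sum_congr rfl fun b' _ => ?_
      rw [h, (d.edgeF.symm f).2, smul_smul, ← op_mul, ghostWord_mul_vert]
    · exact smul_zero _⟩
  map_add' n n' := ext fun b => by
    change ite _ (∑ b', op (d.ghostWord k (d.edgeF.symm f).1.2 b') • (eval b' n + eval b' n')) 0 =
      ite _ (∑ b', op (d.ghostWord k (d.edgeF.symm f).1.2 b') • eval b' n) 0 +
        ite _ (∑ b', op (d.ghostWord k (d.edgeF.symm f).1.2 b') • eval b' n') 0
    simp only [smul_add, Finset.sum_add_distrib]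
    split_ifs
    · rfl
    · exact (add_zero _).symm
  map_smul' c n := ext fun b => by
    change ite _ (∑ b', op (d.ghostWord k (d.edgeF.symm f).1.2 b') •
        op (algebraMap k (Leavitt k E) c) • eval b' n) 0 = op (algebraMap k (Leavitt k E) c) •
      ite _ (∑ b', op (d.ghostWord k (d.edgeF.symm f).1.2 b') • eval b' n) 0
    rw [smul_ite, smul_zero, Finset.smul_sum]
    simp only [smul_algebraMap_comm]

open scoped Classical in
theorem eval_ghostEnd (f : F.Edge) (n : d.Transfer k hE M) (b : d.S) :
    eval b (ghostEnd hE M f n) = if b = (d.edgeF.symm f).1.1 then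
      ∑ b', op (d.ghostWord k (d.edgeF.symm f).1.2 b') • eval b' n else 0 := rfl

/-- The action of a generator of `L_k(F)`. -/
noncomputable def genEnd (hE : E.NoSinks) (M : Type u) [AddCommGroup M]
    [Module (Leavitt k E)ᵐᵒᵖ M] : LeavittGen F → Module.End k (d.Transfer k hE M)
  | vert w => vertEnd hE M w
  | edge f => edgeEnd hE M f
  | ghost f => ghostEnd hE M f

/-- The action of the free algebra on the generators of `L_k(F)`. -/
noncomputable def freeAction (hE : E.NoSinks) (M : Type u) [AddCommGroup M]
    [Module (Leavitt k E)ᵐᵒᵖ M] :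
    FreeAlgebra k (LeavittGen F) →ₐ[k] (Module.End k (d.Transfer k hE M))ᵐᵒᵖ :=
  FreeAlgebra.lift k fun x => op (genEnd hE M x)

theorem freeAction_gen (x : LeavittGen F) :
    freeAction (k := k) (d := d) hE M (gen k F x) = op (genEnd hE M x) :=
  FreeAlgebra.lift_ι_apply _ _

/-- The relations of `F` are checked coefficientwise: (CK1) for `F` comes from (CK1) for `E`, and
(CK2) for `F` from (CK2) for `E`, which is where the absence of sinks in `E` enters. -/
theorem freeAction_rel {x y : FreeAlgebra k (LeavittGen F)} (h : LeavittRel k F x y) :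
    freeAction (k := k) (d := d) hE M x = freeAction hE M y := by
  classical
  apply unop_injective
  refine LinearMap.ext fun n => ext fun b => ?_
  cases h with
  | one =>
    simp only [map_sum, freeAction_gen, genEnd, map_one, unop_one, Module.End.one_apply,
      Finset.unop_sum, unop_op, LinearMap.sum_apply, eval_vertEnd]
    simp
  | vert_mul v w =>
    rw [apply_ite (freeAction hE M)]
    simp only [map_mul, freeAction_gen, genEnd, unop_mul, unop_op, Module.End.mul_apply, map_zero,
      eval_vertEnd]
    by_cases hvw : v = w
    · subst hvw
      rw [if_pos rfl, unop_op, eval_vertEnd]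
      split_ifs <;> rfl
    · rw [if_neg hvw, unop_zero, LinearMap.zero_apply, map_zero]
      split_ifs with h₁ h₂
      · exact absurd (h₂.symm.trans h₁) hvw
      · rfl
      · rfl
  | source_edge f =>
    simp only [map_mul, freeAction_gen, genEnd, unop_mul, unop_op, Module.End.mul_apply,
      eval_edgeEnd, eval_vertEnd]
    rw [if_pos]
    rw [← d.s_edgeF, Equiv.apply_symm_apply]
  | edge_range f =>
    simp only [map_mul, freeAction_gen, genEnd, unop_mul, unop_op, Module.End.mul_apply,
      eval_edgeEnd, eval_vertEnd]
    split_ifs with h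
    · rfl
    · rw [word_eq_zero, op_zero, zero_smul]
      rw [← d.r_edgeF, Equiv.apply_symm_apply]
      exact fun h' => h h'.symm
  | range_ghost f =>
    simp only [map_mul, freeAction_gen, genEnd, unop_mul, unop_op, Module.End.mul_apply,
      eval_ghostEnd, eval_vertEnd]
    congr 1
    refine Finset.sum_congr rfl fun b' _ => ?_
    split_ifs with h
    · rfl
    · rw [ghostWord_eq_zero, op_zero, zero_smul, zero_smul]
      rw [← d.r_edgeF, Equiv.apply_symm_apply]
      exact fun h' => h h'.symm
  | ghost_source f =>
    simp only [map_mul, freeAction_gen, genEnd, unop_mul, unop_op, Module.End.mul_apply,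
      eval_ghostEnd, eval_vertEnd]
    by_cases hb : b = (d.edgeF.symm f).1.1
    · rw [if_pos]
      rw [hb, ← d.s_edgeF, Equiv.apply_symm_apply]
    · rw [if_neg hb, ite_self]
  | ck1 e f =>
    rw [apply_ite (freeAction hE M)]
    simp only [map_mul, freeAction_gen, genEnd, unop_mul, unop_op, Module.End.mul_apply, map_zero,
      eval_ghostEnd, eval_edgeEnd]
    by_cases hef : e = f
    · subst hef
      rw [if_pos rfl, if_pos rfl, unop_op, eval_vertEnd, Finset.smul_sum]
      -- In `∑ n(b') (ab')* (ab)` only `b' = b` survives, leaving `n(b) r(b) = n(b)` when `a` and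
      -- `b` are composable.
      simp only [smul_smul, ← op_mul, ghostWord_mul_word, true_and]
      rw [Finset.sum_eq_single b]
      · simp only [true_and]
        rw [← d.r_edgeF, Equiv.apply_symm_apply]
        split_ifs with h₁ h₂ h₂
        · exact vert_smul_eval b n
        · exact absurd h₁.symm h₂
        · exact absurd h₂.symm h₁
        · rw [op_zero, zero_smul]
      · intro b' _ hb'
        rw [if_neg fun h => hb' h.1, op_zero, zero_smul]
      · simp
    · rw [if_neg hef, unop_zero, LinearMap.zero_apply, map_zero]
      split_ifs with h
      · rw [Finset.smul_sum]
        refine Finset.sum_eq_zero fun b' _ => ?_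
        rw [smul_smul, ← op_mul, ghostWord_mul_word, if_neg, op_zero, zero_smul]
        exact fun h' => hef (d.edgeF.symm.injective (Subtype.ext (Prod.ext h.symm h'.1)))
      · exact smul_zero _
  | ck2 w hw =>
    simp only [map_sum, map_mul, freeAction_gen, genEnd, unop_mul, unop_op, Module.End.mul_apply,
      Finset.unop_sum, LinearMap.sum_apply, eval_vertEnd, eval_ghostEnd, eval_edgeEnd]
    rw [Finset.sum_filter]
    -- The edges of `F` are extended to all pairs `(b₀, a)`; the conditions make the additional
    -- terms vanish. For fixed `b` there remains the sum over the edges `ab'` of `E` which begin at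
    -- `r(b)`.
    trans ∑ b₀, ∑ a, if b₀ = b then if d.sS b = w then if d.sR a = d.rS b then
      ∑ b', op (d.ghostWord k a b') • op (d.word k a b') • eval b n else 0 else 0 else 0
    · rw [Finset.sum_eq_single b (fun b₀ _ h => by simp [h]) (by simp)]
      simp only [if_true]
      split_ifs
      · conv_lhs => rw [← vert_smul_eval b n, ← d.sum_word_mul_ghostWord k hE, Finset.op_sum,
          Finset.sum_smul]
        refine Finset.sum_congr rfl fun a _ => ?_
        rw [Finset.op_sum, Finset.sum_smul]
        split_ifs
        · simp only [op_mul, mul_smul]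
        · simp
      · rw [Finset.sum_const_zero]
    · rw [← Fintype.sum_prod_type']
      symm
      refine Fintype.sum_of_injective (fun f => (d.edgeF.symm f).1)
        (Subtype.val_injective.comp d.edgeF.symm.injective) _ _ (fun p hp => ?_) fun f => ?_
      · split_ifs with h₁ h₂ h₃
        · exact absurd ⟨d.edgeF ⟨p, by rw [h₃, h₁]⟩, by simp⟩ hp
        all_goals rfl
      · have hs := d.s_edgeF (d.edgeF.symm f)
        have hr := (d.edgeF.symm f).2
        rw [Equiv.apply_symm_apply] at hs
        by_cases hb : b = (d.edgeF.symm f).1.1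
        · rw [if_pos hb, if_pos hb.symm, hs, ← hr, if_pos (congrArg d.rS hb.symm), ← hb]
        · rw [if_neg hb, if_neg (Ne.symm hb), ite_self]

/-- The action of `L_k(F)`. -/
noncomputable def action (hE : E.NoSinks) (M : Type u) [AddCommGroup M]
    [Module (Leavitt k E)ᵐᵒᵖ M] : Leavitt k F →ₐ[k] (Module.End k (d.Transfer k hE M))ᵐᵒᵖ :=
  RingQuot.liftAlgHom k ⟨freeAction hE M, fun _ _ => freeAction_rel⟩

/-- The proof that `E` has no sinks is a parameter of the type `Transfer`, so that instance search
can supply it to `action`. -/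
noncomputable instance : Module (Leavitt k F)ᵐᵒᵖ (d.Transfer k hE M) where
  smul r n := (action hE M r.unop).unop n
  one_smul n := by
    change (action hE M 1).unop n = n
    rw [map_one]
    rfl
  mul_smul r r' n := by
    change (action hE M (r'.unop * r.unop)).unop n = _
    rw [map_mul]
    rfl
  smul_zero r := map_zero (action hE M r.unop).unop
  smul_add r := map_add (action hE M r.unop).unop
  add_smul r r' n := by
    change (action hE M (r.unop + r'.unop)).unop n = _
    rw [map_add]
    rfl
  zero_smul n := by
    change (action hE M 0).unop n = _
    rw [map_zero]
    rfl

theorem gen_smul (x : LeavittGen F) (n : d.Transfer k hE M) :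
    op (of k F x) • n = genEnd hE M x n := by
  change (action hE M (of k F x)).unop n = _
  rw [action, of, RingQuot.liftAlgHom_mkAlgHom_apply, freeAction_gen]
  rfl

theorem algebraMap_smul (c : k) (n : d.Transfer k hE M) :
    op (algebraMap k (Leavitt k F) c) • n = c • n := by
  change (action hE M (algebraMap k (Leavitt k F) c)).unop n = _
  rw [AlgHom.commutes]
  rfl

theorem eval_algebraMap_smul (b : d.S) (c : k) (n : d.Transfer k hE M) :
    eval b (op (algebraMap k (Leavitt k F) c) • n) =
      op (algebraMap k (Leavitt k E) c) • eval b n := by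
  rw [algebraMap_smul, eval_smul]

open scoped Classical in
theorem eval_vert_smul (w : F.Vert) (n : d.Transfer k hE M) (b : d.S) :
    eval b (op (of k F (vert w)) • n) = if d.sS b = w then eval b n else 0 := by
  rw [gen_smul]
  rfl

theorem eval_edge_smul (f : F.Edge) (n : d.Transfer k hE M) (b : d.S) :
    eval b (op (of k F (edge f)) • n) =
      op (d.word k (d.edgeF.symm f).1.2 b) • eval (d.edgeF.symm f).1.1 n := by
  rw [gen_smul]
  rfl

open scoped Classical in
theorem eval_ghost_smul (f : F.Edge) (n : d.Transfer k hE M) (b : d.S) :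
    eval b (op (of k F (ghost f)) • n) = if b = (d.edgeF.symm f).1.1 then
      ∑ b', op (d.ghostWord k (d.edgeF.symm f).1.2 b') • eval b' n else 0 := by
  rw [gen_smul]
  rfl

variable {M' : Type u} [AddCommGroup M'] [Module (Leavitt k E)ᵐᵒᵖ M']

/-- The homomorphism of the transferred modules which belongs to a homomorphism of modules. -/
noncomputable def map (hE : E.NoSinks) (g : M →ₗ[(Leavitt k E)ᵐᵒᵖ] M') :
    d.Transfer k hE M →ₗ[(Leavitt k F)ᵐᵒᵖ] d.Transfer k hE M' :=
  let g' : d.Transfer k hE M →+ d.Transfer k hE M' := AddMonoidHom.mk'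
    (fun n => ⟨fun b => g (eval b n), fun b => by rw [← map_smul, vert_smul_eval]⟩)
    fun n n' => ext fun b => map_add g (eval b n) (eval b n')
  have h (b : d.S) (n : d.Transfer k hE M) : eval b (g' n) = g (eval b n) := rfl
  { g' with
    map_smul' := map_op_smul g'
      (fun c n => ext fun b => by rw [h, eval_algebraMap_smul, eval_algebraMap_smul, map_smul, h])
      fun x n => ext fun b => by
        classical
        rw [h]
        cases x with
        | vert w => rw [eval_vert_smul, eval_vert_smul, h, apply_ite g, map_zero]
        | edge f => rw [eval_edge_smul, eval_edge_smul, h, map_smul]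
        | ghost f =>
          rw [eval_ghost_smul, eval_ghost_smul, apply_ite g, map_zero, map_sum]
          simp only [map_smul, h] }

/-- The element of the transferred module with value `m r(b)` at `b` and value `0` elsewhere. -/
noncomputable def single (b : d.S) : M →+ d.Transfer k hE M := by
  classical
  exact AddMonoidHom.mk' (fun m => ⟨Pi.single b (op (of k E (vert (d.rS b))) • m), fun b' => by
    by_cases h : b' = b
    · subst h
      rw [Pi.single_eq_same, smul_smul, ← op_mul, vert_mul_self]
    · rw [Pi.single_eq_of_ne h, smul_zero]⟩)
    fun m m' => Subtype.ext (by
      change Pi.single b _ = Pi.single b _ + Pi.single b _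
      rw [smul_add, Pi.single_add])

open scoped Classical in
theorem eval_single (b b' : d.S) (m : M) : eval b' (single (k := k) (hE := hE) b m) =
    if b' = b then op (of k E (vert (d.rS b))) • m else 0 :=
  Pi.single_apply (M := M) b (op (of k E (vert (d.rS b))) • m) b'

theorem sum_single_eval (n : d.Transfer k hE M) : ∑ b, single b (eval b n) = n := by
  classical
  refine ext fun b => ?_
  rw [map_sum]
  simp only [eval_single]
  rw [Finset.sum_ite_eq, if_pos (Finset.mem_univ b), vert_smul_eval]

/-- The functions with values in a given subgroup. -/
def submodule (U : AddSubgroup M) : AddSubgroup (d.Transfer k hE M) where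
  carrier := {n | ∀ b, eval b n ∈ U}
  zero_mem' b := by rw [map_zero]; exact U.zero_mem
  add_mem' hm hn b := by rw [map_add]; exact U.add_mem (hm b) (hn b)
  neg_mem' hn b := by rw [map_neg]; exact U.neg_mem (hn b)

theorem isInternal {D : ℤ → AddSubgroup M} (hD : DirectSum.IsInternal D)
    (hv : ∀ (v : E.Vert) (g : ℤ) (m : M), m ∈ D g → op (of k E (vert v)) • m ∈ D g) :
    DirectSum.IsInternal fun g => submodule (k := k) (d := d) (hE := hE) (D g) := by
  constructor
  · rw [injective_iff_map_eq_zero]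
    intro x hx
    -- Each evaluation maps a relation between homogeneous functions to a relation between
    -- homogeneous elements of `M`, where it must be trivial.
    have key (b : d.S) : DirectSum.map (fun g => AddMonoidHom.mk'
        (fun n : submodule (k := k) (d := d) (hE := hE) (D g) => (⟨eval b n.1, n.2 b⟩ : D g))
          fun n n' => Subtype.ext (map_add (eval b) n.1 n'.1)) x = 0 := by
      apply hD.injective
      rw [map_zero, ← map_zero (eval (k := k) (d := d) (hE := hE) (M := M) b), ← hx]
      clear hx
      induction x using DirectSum.induction_on with
      | zero => simp only [map_zero]
      | of g n => rw [DirectSum.map_of, DirectSum.coeAddMonoidHom_of, DirectSum.coeAddMonoidHom_of]; rfl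
      | add x y hx hy => simp only [map_add, hx, hy]
    refine DFinsupp.ext fun g => Subtype.ext (ext fun b => ?_)
    have := congrArg (fun y : DirectSum ℤ fun g => D g => (y g : M)) (key b)
    simp only [DirectSum.map_apply] at this
    exact this.trans (map_zero (eval b)).symm
  · rw [← AddMonoidHom.range_eq_top, eq_top_iff]
    intro n _
    -- A function is the sum of its values placed at single points, and each value is a sum of
    -- homogeneous elements. The factor `r(b)` in `single` has degree zero and so does not disturb
    -- degrees.
    rw [← sum_single_eval n]
    refine AddSubgroup.sum_mem _ fun b _ => ?_
    obtain ⟨y, hy⟩ := hD.surjective (eval b n)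
    rw [← hy]
    clear hy
    induction y using DirectSum.induction_on with
    | zero => simp only [map_zero]; exact AddSubgroup.zero_mem _
    | add x y hx hy => simp only [map_add]; exact AddSubgroup.add_mem _ hx hy
    | of g m =>
      rw [DirectSum.coeAddMonoidHom_of]
      refine ⟨DirectSum.of (fun g => submodule (k := k) (d := d) (hE := hE) (D g)) g
        ⟨single b m.1, fun b' => ?_⟩, DirectSum.coeAddMonoidHom_of _ _ _⟩
      classical
      rw [eval_single]
      split_ifs
      · exact hv _ _ _ m.2
      · exact (D g).zero_mem

end Transfer

end Factorization

/-! ### The grading of a Leavitt path algebra -/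

namespace Leavitt

open LeavittGen

variable (k : Type u) [Field k] (E : FiniteGraph.{u})

theorem path_mul_ghostPath_mem_grading {u v w : E.Vert} (α : E.Path u w) (β : E.Path v w) {n : ℤ}
    (h : (α.length : ℤ) - β.length = n) : path k α * ghostPath k β ∈ grading k E n :=
  Submodule.subset_span ⟨u, v, w, α, β, h, rfl⟩

theorem vert_mem_grading (v : E.Vert) : of k E (vert v) ∈ grading k E 0 := by
  rw [← vert_mul_self]
  exact path_mul_ghostPath_mem_grading k E (.nil v) (.nil v) rfl

theorem edge_mem_grading (e : E.Edge) : of k E (edge e) ∈ grading k E 1 := by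
  have := path_mul_ghostPath_mem_grading k E (.cons e (.nil _)) (.nil _) (n := 1) rfl
  simpa only [path, ghostPath, edge_mul_range] using this

theorem ghost_mem_grading (e : E.Edge) : of k E (ghost e) ∈ grading k E (-1) := by
  have := path_mul_ghostPath_mem_grading k E (.nil _) (.cons e (.nil _)) (n := -1) rfl
  simpa only [path, ghostPath, range_mul_ghost] using this

theorem algebraMap_mem_grading (c : k) : algebraMap k (Leavitt k E) c ∈ grading k E 0 := by
  rw [Algebra.algebraMap_eq_smul_one, ← sum_vert]
  exact Submodule.smul_mem _ c (Submodule.sum_mem _ fun v _ => vert_mem_grading k E v)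

variable {k E} {M : Type u} [AddCommGroup M] [Module (Leavitt k E)ᵐᵒᵖ M]

/-- Whether a family of subgroups of a module is compatible with the grading of the Leavitt path
algebra can be checked on the scalars of `k` and the generators. -/
theorem op_smul_mem {D : ℤ → AddSubgroup M}
    (hk : ∀ (c : k) (g : ℤ) (m : M), m ∈ D g → op (algebraMap k (Leavitt k E) c) • m ∈ D g)
    (hv : ∀ (v : E.Vert) (g : ℤ) (m : M), m ∈ D g → op (of k E (vert v)) • m ∈ D g)
    (he : ∀ (e : E.Edge) (g : ℤ) (m : M), m ∈ D g → op (of k E (edge e)) • m ∈ D (g + 1))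
    (hg : ∀ (e : E.Edge) (g : ℤ) (m : M), m ∈ D g → op (of k E (ghost e)) • m ∈ D (g - 1))
    {g h : ℤ} {m : M} {a : Leavitt k E} (hm : m ∈ D g) (ha : a ∈ grading k E h) :
    op a • m ∈ D (g + h) := by
  have hpath : ∀ {u w : E.Vert} (α : E.Path u w) (g : ℤ) (m : M), m ∈ D g →
      op (path k α) • m ∈ D (g + α.length) := by
    intro u w α
    induction α with
    | nil v =>
      intro g m hm
      rw [Path.length, Nat.cast_zero, add_zero]
      exact hv v g m hm
    | cons e p ih =>
      intro g m hm
      rw [path, op_mul, mul_smul, Path.length, Nat.cast_add, Nat.cast_one, add_comm (p.length : ℤ),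
        ← add_assoc]
      exact ih _ _ (he e g m hm)
  have hghost : ∀ {u w : E.Vert} (α : E.Path u w) (g : ℤ) (m : M), m ∈ D g →
      op (ghostPath k α) • m ∈ D (g - α.length) := by
    intro u w α
    induction α with
    | nil v =>
      intro g m hm
      rw [Path.length, Nat.cast_zero, sub_zero]
      exact hv v g m hm
    | cons e p ih =>
      intro g m hm
      rw [ghostPath, op_mul, mul_smul, Path.length, Nat.cast_add, Nat.cast_one, ← sub_sub]
      exact hg e _ _ (ih g m hm)
  induction ha using Submodule.span_induction with
  | mem x hx =>
    obtain ⟨u, v, w, α, β, rfl, rfl⟩ := hx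
    rw [op_mul, mul_smul, ← add_sub_assoc]
    exact hghost β _ _ (hpath α _ _ hm)
  | zero => rw [op_zero, zero_smul]; exact (D (g + h)).zero_mem
  | add x y _ _ hx hy => rw [MulOpposite.op_add, add_smul]; exact (D (g + h)).add_mem hx hy
  | smul c x _ hx =>
    rw [Algebra.smul_def, Algebra.commutes, op_mul, mul_smul]
    exact hk c _ _ hx

end Leavitt

namespace GrMod

theorem op_smul_mem_of_degree_zero {R : Type u} [Ring R] {𝒜 : ℤ → AddSubgroup R} (M : GrMod R 𝒜)
    {a : R} (ha : a ∈ 𝒜 0) {g : ℤ} {m : M.toMod} (hm : m ∈ M.deg g) : op a • m ∈ M.deg g := by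
  have := M.smul_mem hm ha
  rwa [add_zero] at this

end GrMod

namespace Factorization

open Leavitt LeavittGen

variable (k : Type u) [Field k] {E F : FiniteGraph.{u}} (d : Factorization E F)

theorem word_mem_grading (a : d.R) (b : d.S) : d.word k a b ∈ grading k E 1 := by
  rw [word]
  split_ifs
  · exact edge_mem_grading k E _
  · exact AddSubgroup.zero_mem _

theorem ghostWord_mem_grading (a : d.R) (b : d.S) : d.ghostWord k a b ∈ grading k E (-1) := by
  rw [ghostWord]
  split_ifs
  · exact ghost_mem_grading k E _
  · exact AddSubgroup.zero_mem _

theorem sum_word_mul_ghostWord_eq_one (hE : E.NoSinks) :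
    ∑ a, ∑ b, d.word k a b * d.ghostWord k a b = 1 := by
  classical
  rw [← sum_vert k E]
  simp only [← d.sum_word_mul_ghostWord k hE]
  symm
  rw [Finset.sum_comm]
  refine Finset.sum_congr rfl fun a _ => ?_
  rw [Finset.sum_comm]
  refine Finset.sum_congr rfl fun b _ => ?_
  rw [Finset.sum_ite_eq, if_pos (Finset.mem_univ _)]

/-- The functor `Mod-L_k(E) ⥤ Mod-L_k(F)`. -/
noncomputable def modFunctor (hE : E.NoSinks) :
    ModuleCat.{u} (Leavitt k E)ᵐᵒᵖ ⥤ ModuleCat.{u} (Leavitt k F)ᵐᵒᵖ where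
  obj M := ModuleCat.of _ (d.Transfer k hE M)
  map f := ModuleCat.ofHom (Transfer.map hE f.hom)

/-- The functor `Gr-L_k(E) ⥤ Gr-L_k(F)`. -/
noncomputable def grFunctor (hE : E.NoSinks) :
    GrMod (Leavitt k E) (grading k E) ⥤ GrMod (Leavitt k F) (grading k F) where
  obj M :=
    { toMod := (d.modFunctor k hE).obj M.toMod
      deg g := Transfer.submodule (k := k) (d := d) (hE := hE) (M.deg g)
      isInternal := Transfer.isInternal M.isInternal fun v _ _ hm =>
        M.op_smul_mem_of_degree_zero (vert_mem_grading k E v) hm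
      smul_mem _ _ _ _ hm ha := by
        refine op_smul_mem (M := d.Transfer k hE M.toMod)
          (D := fun g => Transfer.submodule (M.deg g)) (fun c g n hn b => ?_)
          (fun w g n hn b => ?_) (fun f g n hn b => ?_) (fun f g n hn b => ?_) hm ha
        · rw [Transfer.eval_algebraMap_smul]
          exact M.op_smul_mem_of_degree_zero (algebraMap_mem_grading k E c) (hn b)
        · classical
          rw [Transfer.eval_vert_smul]
          split_ifs
          · exact hn b
          · exact (M.deg g).zero_mem
        · rw [Transfer.eval_edge_smul]
          exact M.smul_mem (hn _) (d.word_mem_grading k _ _)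
        · classical
          rw [Transfer.eval_ghost_smul]
          split_ifs
          · exact AddSubgroup.sum_mem _ fun b' _ => M.smul_mem (hn _) (d.ghostWord_mem_grading k _ _)
          · exact AddSubgroup.zero_mem _ }
  map f :=
    { toHom := (d.modFunctor k hE).map f.toHom
      map_deg := fun g _ hm b => f.map_deg g _ (hm b) }

/-- The degree of a transferred element is that of its values, so a suspension reindexes both sides
alike, and the equality of functors holds by definition. -/
theorem isGradedFunctorGr_grFunctor (hE : E.NoSinks) : IsGradedFunctorGr (d.grFunctor k hE) :=
  fun _ => rfl

theorem isGradedFunctorMod_modFunctor (hE : E.NoSinks) :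
    IsGradedFunctorMod (grading k E) (grading k F) (d.modFunctor k hE) :=
  ⟨d.grFunctor k hE, d.isGradedFunctorGr_grFunctor k hE, rfl⟩

theorem word_mul_word_eq_zero {a a' : d.R} {b b' : d.S} (h : d.rS b ≠ d.sR a') :
    d.word k a b * d.word k a' b' = 0 := by
  rw [← word_mul_vert, mul_assoc, vert_mul_word, if_neg h, mul_zero]

/-! ### The twice transferred module. -/

namespace Transfer

variable {k d} {hE : E.NoSinks} {hF : F.NoSinks} {M : Type u} [AddCommGroup M]
  [Module (Leavitt k E)ᵐᵒᵖ M]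

/-- The value of an element of the twice transferred module at `a` and `b`. -/
noncomputable def eval₂ (a : d.R) (b : d.S) : d.swap.Transfer k hF (d.Transfer k hE M) →+ M :=
  (eval b).comp (eval (d := d.swap) a)

theorem ext₂ {n n' : d.swap.Transfer k hF (d.Transfer k hE M)}
    (h : ∀ a b, eval₂ a b n = eval₂ a b n') : n = n' :=
  ext fun a => ext fun b => h a b

/-- The outer value at `a` is fixed by the vertex `r(a)` of `F`, which acts on the inner functions
by restricting them to the `b` with `s(b) = r(a)`. -/
theorem eval₂_eq_zero {a : d.R} {b : d.S} (h : d.rR a ≠ d.sS b)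
    (n : d.swap.Transfer k hF (d.Transfer k hE M)) : eval₂ a b n = 0 := by
  classical
  have h' : op (of k F (vert (d.rR a))) • eval (d := d.swap) a n = eval (d := d.swap) a n :=
    vert_smul_eval (d := d.swap) a n
  change eval b (eval (d := d.swap) a n) = 0
  rw [← h', eval_vert_smul, if_neg h.symm]

theorem eval₂_algebraMap_smul (c : k) (n : d.swap.Transfer k hF (d.Transfer k hE M)) (a : d.R)
    (b : d.S) : eval₂ a b (op (algebraMap k (Leavitt k E) c) • n) =
      op (algebraMap k (Leavitt k E) c) • eval₂ a b n := by
  change eval b (eval (d := d.swap) a (op (algebraMap k (Leavitt k E) c) • n)) = _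
  rw [eval_algebraMap_smul, eval_algebraMap_smul]
  rfl

open scoped Classical in
theorem eval₂_vert_smul (v : E.Vert) (n : d.swap.Transfer k hF (d.Transfer k hE M)) (a : d.R)
    (b : d.S) : eval₂ a b (op (of k E (vert v)) • n) = if d.sR a = v then eval₂ a b n else 0 := by
  change eval b (eval (d := d.swap) a (op (of k E (vert v)) • n)) = _
  rw [eval_vert_smul, apply_ite (eval b), map_zero]
  rfl

-- Here `e = a₀ b₀` acts on the outer level through the edge `b₀ a` of `F`, and that edge acts on
-- the inner level through `ab`. The condition says that `b₀ a` is a path.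
open scoped Classical in
theorem eval₂_edge_smul (e : E.Edge) (n : d.swap.Transfer k hF (d.Transfer k hE M)) (a : d.R)
    (b : d.S) : eval₂ a b (op (of k E (edge e)) • n) =
      if d.rS (d.edgeE.symm e).1.2 = d.sR a then
        op (d.word k a b) • eval₂ (d.edgeE.symm e).1.1 (d.edgeE.symm e).1.2 n else 0 := by
  change eval b (eval (d := d.swap) a (op (of k E (edge e)) • n)) = _
  rw [eval_edge_smul]
  change eval b (op (d.swap.word k (d.edgeE.symm e).1.2 a) •
    eval (d := d.swap) (d.edgeE.symm e).1.1 n) = _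
  by_cases h : d.rS (d.edgeE.symm e).1.2 = d.sR a
  · rw [if_pos h]
    have : d.swap.word k (d.edgeE.symm e).1.2 a =
      of k F (edge (d.edgeF ⟨((d.edgeE.symm e).1.2, a), h⟩)) := dif_pos h
    rw [this, eval_edge_smul, Equiv.symm_apply_apply]
    rfl
  · rw [if_neg h]
    have : d.swap.word k (d.edgeE.symm e).1.2 a = 0 := dif_neg h
    rw [this, op_zero, zero_smul, map_zero]

open scoped Classical in
theorem eval₂_ghost_smul (e : E.Edge) (n : d.swap.Transfer k hF (d.Transfer k hE M)) (a : d.R)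
    (b : d.S) : eval₂ a b (op (of k E (ghost e)) • n) =
      if a = (d.edgeE.symm e).1.1 ∧ b = (d.edgeE.symm e).1.2 then
        ∑ a', ∑ b', (if d.sR a' = d.rS b then op (d.ghostWord k a' b') • eval₂ a' b' n else 0)
      else 0 := by
  change eval b (eval (d := d.swap) a (op (of k E (ghost e)) • n)) = _
  rw [eval_ghost_smul]
  change eval b (if a = (d.edgeE.symm e).1.1 then
    ∑ a', op (d.swap.ghostWord k (d.edgeE.symm e).1.2 a') • eval (d := d.swap) a' n else 0) = _
  rw [ite_and, apply_ite (eval b), map_zero]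
  refine if_congr Iff.rfl ?_ rfl
  rw [map_sum]
  have key (a' : d.R) : eval b (op (d.swap.ghostWord k (d.edgeE.symm e).1.2 a') •
      eval (d := d.swap) a' n) = if b = (d.edgeE.symm e).1.2 then
        ∑ b', (if d.sR a' = d.rS b then op (d.ghostWord k a' b') • eval₂ a' b' n else 0) else 0 := by
    by_cases h : d.rS (d.edgeE.symm e).1.2 = d.sR a'
    · have : d.swap.ghostWord k (d.edgeE.symm e).1.2 a' =
        of k F (ghost (d.edgeF ⟨((d.edgeE.symm e).1.2, a'), h⟩)) := dif_pos h
      rw [this, eval_ghost_smul, Equiv.symm_apply_apply]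
      refine ite_congr rfl (fun hb => ?_) fun _ => rfl
      simp only [hb, h, if_true]
      rfl
    · have : d.swap.ghostWord k (d.edgeE.symm e).1.2 a' = 0 := dif_neg h
      rw [this, op_zero, zero_smul, map_zero]
      split_ifs with hb h'
      · exact absurd (hb ▸ h').symm h
      · exact Finset.sum_const_zero.symm
      · rfl
  refine (Finset.sum_congr rfl fun a' _ => key a').trans ?_
  split_ifs
  · rfl
  · exact Finset.sum_const_zero

/-- The map `m ↦ (b ↦ m a b)`. -/
noncomputable def mulWord (hE : E.NoSinks) (a : d.R) : M →+ d.Transfer k hE M :=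
  AddMonoidHom.mk' (fun m => ⟨fun b => op (d.word k a b) • m, fun b => by
    beta_reduce
    rw [smul_smul, ← op_mul, word_mul_vert]⟩) fun m m' => ext fun b => smul_add (op _) m m'

theorem eval_mulWord (a : d.R) (b : d.S) (m : M) :
    eval b (mulWord (k := k) hE a m) = op (d.word k a b) • m := rfl

theorem vert_smul_mulWord (a : d.R) (m : M) :
    op (of k F (vert (d.rR a))) • mulWord (k := k) hE a m = mulWord hE a m := by
  classical
  refine ext fun b => ?_
  rw [eval_vert_smul, eval_mulWord]
  split_ifs with h
  · rfl
  · rw [word_eq_zero k (Ne.symm h), op_zero, zero_smul]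

/-- The map `m ↦ ((a, b) ↦ m a b)`. -/
noncomputable def toTransfer₂ (hE : E.NoSinks) (hF : F.NoSinks) :
    M →+ d.swap.Transfer k hF (d.Transfer k hE M) :=
  AddMonoidHom.mk' (fun m => ⟨fun a => mulWord hE a m, fun a => vert_smul_mulWord a m⟩)
    fun m m' => ext fun a => map_add (mulWord hE a) m m'

theorem eval₂_toTransfer₂ (m : M) (a : d.R) (b : d.S) :
    eval₂ a b (toTransfer₂ (k := k) hE hF m) = op (d.word k a b) • m := rfl

/-- On generators, the value of the image of `m x` at `(a, b)` is `m x (ab)`. For an edge `x` the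
word `ab` must continue the path, and for a ghost edge (CK1) forces `x = (ab)*`. -/
theorem toTransfer₂_smul (r : (Leavitt k E)ᵐᵒᵖ) (m : M) :
    toTransfer₂ (k := k) (d := d) hE hF (r • m) = r • toTransfer₂ hE hF m := by
  classical
  refine map_op_smul _ (fun c m => ext₂ fun a b => ?_) (fun x m => ext₂ fun a b => ?_) r m
  · rw [eval₂_toTransfer₂, eval₂_algebraMap_smul, eval₂_toTransfer₂, smul_algebraMap_comm]
  rw [eval₂_toTransfer₂, smul_smul, ← op_mul]
  cases x with
  | vert v =>
    rw [vert_mul_word, eval₂_vert_smul, eval₂_toTransfer₂]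
    by_cases h : v = d.sR a
    · rw [if_pos h, if_pos h.symm]
    · rw [if_neg h, if_neg (Ne.symm h), op_zero, zero_smul]
  | edge e =>
    rw [eval₂_edge_smul, eval₂_toTransfer₂, smul_smul, ← op_mul, ← d.word_edgeE_symm k e]
    split_ifs with h
    · rfl
    · rw [word_mul_word_eq_zero k d h, op_zero, zero_smul]
  | ghost e =>
    rw [eval₂_ghost_smul, ← d.ghostWord_edgeE_symm k e, ghostWord_mul_word]
    simp only [eval₂_toTransfer₂]
    by_cases h : a = (d.edgeE.symm e).1.1 ∧ b = (d.edgeE.symm e).1.2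
    -- The left side has become `m r(b)`; (CK2) expands `r(b)` into the sum of `(a'b')(a'b')*` on
    -- the right.
    · rw [if_pos h, if_pos ⟨h.1.symm, h.2.symm, (d.edgeE.symm e).2⟩, ← h.2,
        ← d.sum_word_mul_ghostWord k hE]
      simp only [Finset.op_sum, Finset.sum_smul]
      refine Finset.sum_congr rfl fun a' _ => Finset.sum_congr rfl fun b' _ => ?_
      split_ifs
      · rw [op_mul, mul_smul]
      · rw [op_zero, zero_smul]
    · rw [if_neg h, if_neg, op_zero, zero_smul]
      exact fun h' => h ⟨h'.1.symm, h'.2.1.symm⟩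

/-- The map `n ↦ ∑ n(a, b) (ab)*`. -/
noncomputable def ofTransfer₂ (n : d.swap.Transfer k hF (d.Transfer k hE M)) : M :=
  ∑ a, ∑ b, op (d.ghostWord k a b) • eval₂ a b n

theorem ofTransfer₂_toTransfer₂ (m : M) :
    ofTransfer₂ (toTransfer₂ (k := k) (d := d) hE hF m) = m := by
  simp only [ofTransfer₂, eval₂_toTransfer₂, smul_smul, ← op_mul, ← Finset.sum_smul,
    ← Finset.op_sum, d.sum_word_mul_ghostWord_eq_one k hE, op_one, one_smul]

/-- By (CK1), `∑ n(a',b') (a'b')* (ab)` reduces to `n(a,b) r(b) = n(a,b)` for composable pairs; for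
the others `n(a,b)` is already zero. -/
theorem toTransfer₂_ofTransfer₂ (n : d.swap.Transfer k hF (d.Transfer k hE M)) :
    toTransfer₂ hE hF (ofTransfer₂ n) = n := by
  classical
  refine ext₂ fun a b => ?_
  rw [eval₂_toTransfer₂, ofTransfer₂, Finset.smul_sum,
    Finset.sum_eq_single a (fun a' _ h => ?_) (by simp), Finset.smul_sum,
    Finset.sum_eq_single b (fun b' _ h => ?_) (by simp), smul_smul, ← op_mul, ghostWord_mul_word]
  · by_cases h : d.rR a = d.sS b
    · rw [if_pos ⟨rfl, rfl, h⟩]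
      exact vert_smul_eval b _
    · rw [if_neg fun h' => h h'.2.2, eval₂_eq_zero h, op_zero, zero_smul]
  · rw [smul_smul, ← op_mul, ghostWord_mul_word, if_neg fun h' => h h'.2.1, op_zero, zero_smul]
  · rw [Finset.smul_sum]
    refine Finset.sum_eq_zero fun b' _ => ?_
    rw [smul_smul, ← op_mul, ghostWord_mul_word, if_neg fun h' => h h'.1, op_zero, zero_smul]

variable (k d M) in
/-- The isomorphism between a module and the twice transferred module. -/
noncomputable def equiv₂ (hE : E.NoSinks) (hF : F.NoSinks) :
    M ≃ₗ[(Leavitt k E)ᵐᵒᵖ] d.swap.Transfer k hF (d.Transfer k hE M) where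
  toFun := toTransfer₂ hE hF
  map_add' := map_add _
  map_smul' := toTransfer₂_smul
  invFun := ofTransfer₂
  left_inv := ofTransfer₂_toTransfer₂
  right_inv := toTransfer₂_ofTransfer₂

end Transfer

/-- The functors between the categories of modules are inverse to each other. -/
noncomputable def modFunctorIso (hE : E.NoSinks) (hF : F.NoSinks) :
    𝟭 (ModuleCat.{u} (Leavitt k E)ᵐᵒᵖ) ≅ d.modFunctor k hE ⋙ d.swap.modFunctor k hF :=
  NatIso.ofComponents (fun M => (Transfer.equiv₂ k d M hE hF).toModuleIso) fun {M M'} f => by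
    ext m
    exact Transfer.ext₂ (hF := hF) fun a b => (map_smul f.hom (op (d.word k a b)) m).symm

/-- The functors between the categories of graded modules are inverse to each other up to a
suspension. -/
noncomputable def grFunctorIso (hE : E.NoSinks) (hF : F.NoSinks) :
    𝟭 (GrMod (Leavitt k E) (grading k E)) ≅
      d.grFunctor k hE ⋙ d.swap.grFunctor k hF ⋙ GrMod.shiftFunctor _ _ 1 :=
  NatIso.ofComponents (fun M =>
    { hom :=
        { toHom := ((d.modFunctorIso k hE hF).app M.toMod).hom
          -- Multiplication by `ab` raises the degree by one, and degree `g + 1` is degree `g` of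
          -- the suspension by 1.
          map_deg := fun g m hm a b => by
            have := M.smul_mem hm (d.word_mem_grading k a b)
            rwa [add_comm] at this }
      inv :=
        { toHom := ((d.modFunctorIso k hE hF).app M.toMod).inv
          map_deg := fun g n hn => AddSubgroup.sum_mem _ fun a _ => AddSubgroup.sum_mem _ fun b _ => by
            have := M.smul_mem (hn a b) (d.ghostWord_mem_grading k a b)
            rwa [add_neg_cancel_comm] at this }
      hom_inv_id := GrMod.Hom.ext ((d.modFunctorIso k hE hF).app M.toMod).hom_inv_id
      inv_hom_id := GrMod.Hom.ext ((d.modFunctorIso k hE hF).app M.toMod).inv_hom_id })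
    fun f => GrMod.Hom.ext ((d.modFunctorIso k hE hF).hom.naturality f.toHom)

end Factorization

/-! ### Graded Morita equivalence -/

namespace GrMod

variable {R : Type u} [Ring R] {𝒜 : ℤ → AddSubgroup R}

theorem shift_shift_comm (γ δ : ℤ) (M : GrMod R 𝒜) :
    shift γ (shift δ M) = shift δ (shift γ M) := by
  unfold shift
  congr 1
  funext g
  exact congrArg M.deg (add_left_comm _ _ _)

theorem toHom_eqToHom {M N : GrMod R 𝒜} (h : M = N) :
    Hom.toHom (eqToHom h) = eqToHom (congrArg GrMod.toMod h) := by
  subst h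
  rfl

/-- Graded functors must commute with suspensions on the nose, so an equality of functors is needed.
The objects agree only after rearranging `γ + (δ + g)`, but the transport maps are identities on the
underlying modules. -/
theorem shiftFunctor_comm (γ δ : ℤ) : shiftFunctor R 𝒜 γ ⋙ shiftFunctor R 𝒜 δ =
    shiftFunctor R 𝒜 δ ⋙ shiftFunctor R 𝒜 γ := by
  have h (M : GrMod R 𝒜) : shift δ (shift γ M) = shift γ (shift δ M) := shift_shift_comm δ γ M
  refine CategoryTheory.Functor.ext h fun M N f => Hom.ext ?_
  change Hom.toHom (M := M) (N := N) f = Hom.toHom (M := shift δ (shift γ M)) (eqToHom (h M)) ≫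
    Hom.toHom (M := M) (N := N) f ≫ Hom.toHom (M := shift γ (shift δ N)) (eqToHom (h N).symm)
  rw [toHom_eqToHom, toHom_eqToHom]
  change Hom.toHom (M := M) (N := N) f = 𝟙 M.toMod ≫ Hom.toHom (M := M) (N := N) f ≫ 𝟙 N.toMod
  rw [Category.id_comp, Category.comp_id]

end GrMod

section Morita

variable {R S T : Type u} [Ring R] [Ring S] [Ring T] {𝒜 : ℤ → AddSubgroup R}
  {ℬ : ℤ → AddSubgroup S} {𝒞 : ℤ → AddSubgroup T}

theorem isGradedFunctorGr_shiftFunctor (δ : ℤ) : IsGradedFunctorGr (GrMod.shiftFunctor R 𝒜 δ) :=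
  fun γ => GrMod.shiftFunctor_comm δ γ

theorem IsGradedFunctorGr.comp {Φ : GrMod R 𝒜 ⥤ GrMod S ℬ} {Ψ : GrMod S ℬ ⥤ GrMod T 𝒞}
    (hΦ : IsGradedFunctorGr Φ) (hΨ : IsGradedFunctorGr Ψ) : IsGradedFunctorGr (Φ ⋙ Ψ) :=
  fun γ => by
    rw [Functor.assoc, hΨ γ, ← Functor.assoc, hΦ γ, Functor.assoc]

theorem IsGradedFunctorMod.comp {φ : ModuleCat.{u} Rᵐᵒᵖ ⥤ ModuleCat.{u} Sᵐᵒᵖ}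
    {ψ : ModuleCat.{u} Sᵐᵒᵖ ⥤ ModuleCat.{u} Tᵐᵒᵖ} (hφ : IsGradedFunctorMod 𝒜 ℬ φ)
    (hψ : IsGradedFunctorMod ℬ 𝒞 ψ) : IsGradedFunctorMod 𝒜 𝒞 (φ ⋙ ψ) := by
  obtain ⟨Φ, hΦ, h⟩ := hφ
  obtain ⟨Ψ, hΨ, h'⟩ := hψ
  exact ⟨Φ ⋙ Ψ, hΦ.comp hΨ, by rw [Functor.assoc, h', ← Functor.assoc, h, Functor.assoc]⟩

/-- The composite of the first and the last functor is the identity if the inner composite is. -/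
theorem nonempty_comp_iso {A B C : Type*} [Category* A] [Category* B] [Category* C] {f : A ⥤ B}
    {f' : B ⥤ A} {g : B ⥤ C} {g' : C ⥤ B} (h : Nonempty (f ⋙ f' ≅ 𝟭 A))
    (h' : Nonempty (g ⋙ g' ≅ 𝟭 B)) : Nonempty ((f ⋙ g) ⋙ (g' ⋙ f') ≅ 𝟭 A) := by
  obtain ⟨i⟩ := h
  obtain ⟨j⟩ := h'
  exact ⟨Functor.isoWhiskerLeft f (Functor.isoWhiskerRight j f') ≪≫ i⟩

theorem GradedMoritaEquivalent.trans (h : GradedMoritaEquivalent 𝒜 ℬ)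
    (h' : GradedMoritaEquivalent ℬ 𝒞) : GradedMoritaEquivalent 𝒜 𝒞 := by
  obtain ⟨⟨Φ, Γ, hΦ, hΓ, i, j⟩, φ, τ, hφ, p, q⟩ := h
  obtain ⟨⟨Φ', Γ', hΦ', hΓ', i', j'⟩, φ', τ', hφ', p', q'⟩ := h'
  exact ⟨⟨Φ ⋙ Φ', Γ' ⋙ Γ, hΦ.comp hΦ', hΓ'.comp hΓ, nonempty_comp_iso i i',
    nonempty_comp_iso j' j⟩, φ ⋙ φ', τ' ⋙ τ, hφ.comp hφ', nonempty_comp_iso p p',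
    nonempty_comp_iso q' q⟩

end Morita

open Leavitt in
theorem Factorization.gradedMoritaEquivalent (k : Type u) [Field k] {E F : FiniteGraph.{u}}
    (d : Factorization E F) (hE : E.NoSinks) (hF : F.NoSinks) :
    GradedMoritaEquivalent (grading k E) (grading k F) := by
  refine ⟨⟨d.grFunctor k hE, d.swap.grFunctor k hF ⋙ GrMod.shiftFunctor _ _ 1,
    d.isGradedFunctorGr_grFunctor k hE,
    (d.swap.isGradedFunctorGr_grFunctor k hF).comp (isGradedFunctorGr_shiftFunctor 1),
    ⟨(d.grFunctorIso k hE hF).symm⟩, ⟨?_⟩⟩,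
    d.modFunctor k hE, d.swap.modFunctor k hF, d.isGradedFunctorMod_modFunctor k hE,
    ⟨(d.modFunctorIso k hE hF).symm⟩, ⟨(d.swap.modFunctorIso k hF hE).symm⟩⟩
  -- The suspension sits between the two transfer functors; it is moved to the end, where
  -- `grFunctorIso` for the swapped factorization expects it.
  rw [Functor.assoc, ← d.isGradedFunctorGr_grFunctor k hE]
  exact (d.swap.grFunctorIso k hF hE).symm

/-! ### Matrices and graphs -/

theorem mul_apply_ne_zero_iff {m n p : Type*} [Fintype n] (R : Matrix m n ℕ) (S : Matrix n p ℕ)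
    (i : m) (j : p) : (R * S) i j ≠ 0 ↔ ∃ l, R i l ≠ 0 ∧ S l j ≠ 0 := by
  simp [Matrix.mul_apply, Finset.sum_eq_zero_iff]

theorem finite_sigma_fin {V W : Type u} [Finite V] [Finite W] (f : V → W → ℕ) :
    Finite (Σ v w, Fin (f v w)) := inferInstance

namespace SquareMatrix

/-- The graph with a given adjacency matrix. -/
noncomputable def toGraph (A : SquareMatrix.{u}) : FiniteGraph.{u} where
  Vert := A.ι
  Edge := Σ v : A.ι, Σ w : A.ι, Fin (A.mat v w)
  fintypeEdge := @Fintype.ofFinite _ (finite_sigma_fin A.mat)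
  s e := e.1
  r e := e.2.1

/-- An actual equality, so that the intermediate matrices of a chain can be rewritten as adjacency
matrices of graphs. -/
theorem adj_toGraph (A : SquareMatrix.{u}) : A.toGraph.adj = A := by
  obtain @⟨ι, _, A⟩ := A
  have : (toGraph ⟨ι, A⟩).adjMatrix = (A : Matrix ι ι ℕ) := by
    funext v w
    let f : Fin (A v w) → {e : (toGraph ⟨ι, A⟩).Edge //
      (toGraph ⟨ι, A⟩).s e = v ∧ (toGraph ⟨ι, A⟩).r e = w} := fun i => ⟨⟨v, w, i⟩, rfl, rfl⟩
    have hf : Function.Bijective f := by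
      constructor
      · intro i j hij
        have h := eq_of_heq (Sigma.mk.inj (congrArg Subtype.val hij)).2
        exact eq_of_heq (Sigma.mk.inj h).2
      · rintro ⟨⟨v, w, i⟩, rfl, rfl⟩
        exact ⟨i, rfl⟩
    exact (Nat.card_congr (Equiv.ofBijective f hf)).symm.trans (Nat.card_fin _)
  exact congrArg (SquareMatrix.mk ι) this

/-- No row of the matrix is zero. -/
def NoZeroRow (A : SquareMatrix.{u}) : Prop := ∀ v, ∃ w, A.mat v w ≠ 0

/-- The index `v` is the beginning of an infinite path. -/
def Persistent (A : SquareMatrix.{u}) (v : A.ι) : Prop :=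
  ∃ U : Set A.ι, v ∈ U ∧ ∀ x ∈ U, ∃ y ∈ U, A.mat x y ≠ 0

theorem Persistent.exists_succ {A : SquareMatrix.{u}} {v : A.ι} (h : A.Persistent v) :
    ∃ w, A.Persistent w ∧ A.mat v w ≠ 0 := by
  obtain ⟨U, hv, hU⟩ := h
  obtain ⟨w, hw, hvw⟩ := hU v hv
  exact ⟨w, ⟨U, hw, hU⟩, hvw⟩

theorem NoZeroRow.persistent {A : SquareMatrix.{u}} (hA : A.NoZeroRow) (v : A.ι) :
    A.Persistent v :=
  ⟨Set.univ, trivial, fun x _ => (hA x).imp fun _ h => ⟨trivial, h⟩⟩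

theorem Persistent.of_factorization {A B : SquareMatrix.{u}} {R : Matrix A.ι B.ι ℕ}
    {S : Matrix B.ι A.ι ℕ} (hA : A.mat = R * S) (hB : B.mat = S * R) {v : A.ι} {w : B.ι}
    (hw : B.Persistent w) (hvw : R v w ≠ 0) : A.Persistent v := by
  -- An infinite path of `B` is refined to one that alternates between `S` and `R`; its vertices on
  -- the side of `A`, preceded by `v`, form an infinite path of `A`.
  refine ⟨{x | ∃ y, B.Persistent y ∧ R x y ≠ 0}, ⟨w, hw, hvw⟩, ?_⟩
  rintro x ⟨y, hy, hxy⟩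
  obtain ⟨y', hy', h⟩ := hy.exists_succ
  rw [hB, mul_apply_ne_zero_iff] at h
  obtain ⟨z, hz, hz'⟩ := h
  exact ⟨z, ⟨y', hy', hz'⟩, by rw [hA, mul_apply_ne_zero_iff]; exact ⟨y, hxy, hz⟩⟩

open scoped Classical in
/-- The restriction of a matrix to the indices which are the beginnings of infinite paths. -/
noncomputable def trim (A : SquareMatrix.{u}) : SquareMatrix.{u} where
  ι := {v // A.Persistent v}
  mat v w := A.mat v.1 w.1

/-- The inclusion of the indices of the restriction. -/
def trimVal (A : SquareMatrix.{u}) : A.trim.ι → A.ι := Subtype.val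

theorem trimVal_injective (A : SquareMatrix.{u}) : Function.Injective A.trimVal :=
  Subtype.val_injective

theorem exists_trimVal_eq {A : SquareMatrix.{u}} {v : A.ι} (h : A.Persistent v) :
    ∃ w, A.trimVal w = v := ⟨⟨v, h⟩, rfl⟩

theorem persistent_trimVal {A : SquareMatrix.{u}} (v : A.trim.ι) : A.Persistent (A.trimVal v) :=
  v.2

theorem trim_mat {A : SquareMatrix.{u}} :
    A.trim.mat = A.mat.submatrix A.trimVal A.trimVal := rfl

theorem noZeroRow_trim (A : SquareMatrix.{u}) : A.trim.NoZeroRow := fun v => by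
  obtain ⟨w, hw, h⟩ := v.2.exists_succ
  exact ⟨⟨w, hw⟩, h⟩

end SquareMatrix

/-! ### Elementary strong shift equivalence under restriction to persistent indices. -/

namespace ElementarySSE

open SquareMatrix

variable {A B : SquareMatrix.{u}}

theorem symm (h : ElementarySSE A B) : ElementarySSE B A := by
  obtain ⟨R, S, hA, hB⟩ := h
  exact ⟨S, R, hB, hA⟩

/-- Restricting the middle index loses nothing: if `S w v' ≠ 0` and `v'` is persistent, then so is
`w`. -/
theorem trim_mat_eq_mul {R : Matrix A.ι B.ι ℕ} {S : Matrix B.ι A.ι ℕ} (hA : A.mat = R * S)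
    (hB : B.mat = S * R) :
    A.trim.mat = R.submatrix A.trimVal B.trimVal * S.submatrix B.trimVal A.trimVal := by
  ext v v'
  rw [trim_mat, Matrix.submatrix_apply, hA, Matrix.mul_apply, Matrix.mul_apply]
  symm
  refine Fintype.sum_of_injective _ B.trimVal_injective _ _ (fun w hw => ?_) fun _ => rfl
  by_contra h
  exact hw (exists_trimVal_eq (Persistent.of_factorization hB hA (persistent_trimVal v')
    (right_ne_zero_of_mul h)))

protected theorem trim (h : ElementarySSE A B) : ElementarySSE A.trim B.trim := by
  obtain ⟨R, S, hA, hB⟩ := h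
  exact ⟨_, _, trim_mat_eq_mul hA hB, trim_mat_eq_mul hB hA⟩

/-- All indices are persistent, so the restriction is a mere relabelling; the second factor is the
identity matrix with relabelled rows. -/
theorem trim_right (hA : A.NoZeroRow) : ElementarySSE A A.trim := by
  classical
  refine ⟨A.mat.submatrix id A.trimVal, (1 : Matrix A.ι A.ι ℕ).submatrix A.trimVal id, ?_, ?_⟩
  · ext v v'
    obtain ⟨v', rfl⟩ := exists_trimVal_eq (hA.persistent v')
    rw [Matrix.mul_apply, Finset.sum_eq_single v']
    · exact ((congrArg (A.mat v (A.trimVal v') * ·) (Matrix.one_apply_eq (A.trimVal v'))).trans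
        (mul_one _)).symm
    · intro w _ hw
      rw [Matrix.submatrix_apply, Matrix.submatrix_apply, id, Matrix.one_apply_ne, mul_zero]
      exact fun h => hw (A.trimVal_injective h)
    · simp
  · ext v v'
    rw [Matrix.mul_apply, Finset.sum_eq_single (A.trimVal v)]
    · exact ((congrArg (· * A.mat (A.trimVal v) (A.trimVal v'))
        (Matrix.one_apply_eq (A.trimVal v))).trans (one_mul _)).symm
    · intro w _ hw
      rw [Matrix.submatrix_apply, id, Matrix.one_apply_ne hw.symm, zero_mul]
    · simp

end ElementarySSE

namespace FiniteGraph

variable {E F : FiniteGraph.{u}}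

theorem adjMatrix_ne_zero_iff {v w : E.Vert} :
    E.adjMatrix v w ≠ 0 ↔ ∃ e, E.s e = v ∧ E.r e = w := by
  rw [adjMatrix, Nat.card_ne_zero, nonempty_subtype]
  exact and_iff_left inferInstance

theorem noSinks_iff : E.NoSinks ↔ E.adj.NoZeroRow := by
  refine forall_congr' fun v => ⟨?_, ?_⟩
  · rintro ⟨e, he⟩
    exact ⟨E.r e, adjMatrix_ne_zero_iff.2 ⟨e, he, rfl⟩⟩
  · rintro ⟨w, h⟩
    obtain ⟨e, he, -⟩ := adjMatrix_ne_zero_iff.1 h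
    exact ⟨e, he⟩

/-- If the number of edges from `v` to `v'` is `(R S) v v'`, then the edges correspond to the
composable pairs of elements of `R` and `S`. -/
theorem exists_edge_equiv (E : FiniteGraph.{u}) {W : Type u} [Fintype W] (R : Matrix E.Vert W ℕ)
    (S : Matrix W E.Vert ℕ) (h : E.adjMatrix = R * S) :
    ∃ f : {p : (Σ v w, Fin (R v w)) × (Σ w v, Fin (S w v)) // p.1.2.1 = p.2.1} ≃ E.Edge,
      (∀ p, E.s (f p) = p.1.1.1) ∧ ∀ p, E.r (f p) = p.1.2.2.1 := by
  let P := {p : (Σ v w, Fin (R v w)) × (Σ w v, Fin (S w v)) // p.1.2.1 = p.2.1}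
  let f : P → E.Vert × E.Vert := fun p => (p.1.1.1, p.1.2.2.1)
  let g : E.Edge → E.Vert × E.Vert := fun e => (E.s e, E.r e)
  -- A bijection compatible with sources and ranges is assembled from bijections of the fibres over
  -- `(v, v')`, both of which have `∑ w, R v w * S w v'` elements.
  have key (c : E.Vert × E.Vert) : Nonempty ({p // f p = c} ≃ {e // g e = c}) := by
    obtain ⟨v, v'⟩ := c
    let i : (Σ w, Fin (R v w) × Fin (S w v')) → {p // f p = (v, v')} :=
      fun x => ⟨⟨(⟨v, x.1, x.2.1⟩, ⟨x.1, v', x.2.2⟩), rfl⟩, rfl⟩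
    have hi : Function.Bijective i := by
      constructor
      · rintro ⟨w, x, y⟩ ⟨w', x', y'⟩ hxy
        have h₁ := congrArg (fun p => p.1.1.1) hxy
        have h₂ := congrArg (fun p => p.1.1.2) hxy
        simp only [i, Sigma.mk.injEq, heq_eq_eq, true_and] at h₁ h₂
        obtain ⟨rfl, h₁⟩ := h₁
        simp only [heq_eq_eq, Sigma.mk.injEq, true_and] at h₁ h₂
        rw [h₁, h₂]
      · rintro ⟨⟨⟨⟨v, w, x⟩, ⟨w', v', y⟩⟩, h⟩, h'⟩
        cases h
        cases h'
        exact ⟨⟨w, x, y⟩, rfl⟩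
    have h₁ : Nat.card {p // f p = (v, v')} = ∑ w, R v w * S w v' := by
      rw [← Nat.card_congr (Equiv.ofBijective i hi), Nat.card_sigma]
      simp
    have h₂ : Nat.card {e // g e = (v, v')} = ∑ w, R v w * S w v' := by
      rw [← Matrix.mul_apply, ← h, adjMatrix]
      exact Nat.card_congr (Equiv.subtypeEquivRight fun e => Prod.mk.injEq _ _ _ _ ▸ Iff.rfl)
    -- Finiteness matters: `Nat.card` is zero on infinite types, so equal values alone give no
    -- bijection.
    have : Finite P := by
      have := finite_sigma_fin R
      have := finite_sigma_fin S
      exact Subtype.finite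
    exact Finite.card_eq.1 (h₁.trans h₂.symm)
  have hf (p) : g (Equiv.ofFiberEquiv (fun c => (key c).some) p) = f p := Equiv.ofFiberEquiv_map _ _
  exact ⟨Equiv.ofFiberEquiv fun c => (key c).some, fun p => congrArg Prod.fst (hf p),
    fun p => congrArg Prod.snd (hf p)⟩

end FiniteGraph

/-! ### From matrix factorizations to the two conclusions. -/

theorem ElementarySSE.nonempty_factorization {E F : FiniteGraph.{u}}
    (h : ElementarySSE E.adj F.adj) : Nonempty (Factorization E F) := by
  obtain ⟨R, S, hE, hF⟩ := h
  obtain ⟨f, hfs, hfr⟩ := E.exists_edge_equiv (W := F.Vert) R S hE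
  obtain ⟨g, hgs, hgr⟩ := F.exists_edge_equiv (W := E.Vert) S R hF
  exact ⟨{
    R := Σ v : E.Vert, Σ w : F.Vert, Fin (R v w)
    S := Σ w : F.Vert, Σ v : E.Vert, Fin (S w v)
    fintypeR := @Fintype.ofFinite _ (finite_sigma_fin R)
    fintypeS := @Fintype.ofFinite _ (finite_sigma_fin S)
    sR := fun a => a.1
    rR := fun a => a.2.1
    sS := fun b => b.1
    rS := fun b => b.2.1
    edgeE := f
    s_edgeE := hfs
    r_edgeE := hfr
    edgeF := g
    s_edgeF := hgs
    r_edgeF := hgr }⟩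

open Bimodule in
theorem StrongShiftEquivalent.exists_shiftEquivalent (k : Type u) [Field k]
    {E F : FiniteGraph.{u}} (h : StrongShiftEquivalent E.adj F.adj) :
    ∃ m, ShiftEquivalent (edgeBimodule k E) (edgeBimodule k F) m := by
  generalize hB : F.adj = B at h
  induction h generalizing F with
  | single h =>
    subst hB
    obtain ⟨d⟩ := h.nonempty_factorization
    exact ⟨0, d.shiftEquivalent k⟩
  | @tail B C _ h ih =>
    subst hB
    -- The intermediate matrix is realized by a graph; sinks in it do no harm for the bimodules.
    obtain ⟨m, hm⟩ := ih B.adj_toGraph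
    rw [← B.adj_toGraph] at h
    obtain ⟨d⟩ := h.nonempty_factorization
    exact ⟨m + 1, hm.trans (d.shiftEquivalent k)⟩

open Leavitt in
theorem ElementarySSE.gradedMoritaEquivalent (k : Type u) [Field k] {E F : FiniteGraph.{u}}
    (h : ElementarySSE E.adj F.adj) (hE : E.NoSinks) (hF : F.NoSinks) :
    GradedMoritaEquivalent (grading k E) (grading k F) := by
  obtain ⟨d⟩ := h.nonempty_factorization
  exact d.gradedMoritaEquivalent k hE hF

open Leavitt in
theorem StrongShiftEquivalent.gradedMoritaEquivalent (k : Type u) [Field k]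
    {E F : FiniteGraph.{u}} (hE : E.NoSinks) (hF : F.NoSinks)
    (h : StrongShiftEquivalent E.adj F.adj) :
    GradedMoritaEquivalent (grading k E) (grading k F) := by
  -- Intermediate matrices may have zero rows, so the chain is run through the trimmed matrices,
  -- whose graphs have no sinks, and is joined to `E` and `F` by one more elementary step at each
  -- end.
  have hT (A : SquareMatrix.{u}) : A.trim.toGraph.NoSinks := by
    rw [FiniteGraph.noSinks_iff, SquareMatrix.adj_toGraph]
    exact A.noZeroRow_trim
  have step {A B : SquareMatrix.{u}} (h : ElementarySSE A B) :
      GradedMoritaEquivalent (grading k A.trim.toGraph) (grading k B.trim.toGraph) := by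
    refine ElementarySSE.gradedMoritaEquivalent k ?_ (hT A) (hT B)
    rw [SquareMatrix.adj_toGraph, SquareMatrix.adj_toGraph]
    exact h.trim
  have chain {A B : SquareMatrix.{u}} (h : StrongShiftEquivalent A B) :
      GradedMoritaEquivalent (grading k A.trim.toGraph) (grading k B.trim.toGraph) := by
    induction h with
    | single h => exact step h
    | tail _ h ih => exact ih.trans (step h)
  have ends {G : FiniteGraph.{u}} (hG : G.NoSinks) :
      ElementarySSE G.adj G.adj.trim.toGraph.adj := by
    rw [SquareMatrix.adj_toGraph]
    exact ElementarySSE.trim_right (FiniteGraph.noSinks_iff.1 hG)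
  exact ((ends hE).gradedMoritaEquivalent k hE (hT _)).trans <|
    (chain h).trans ((ends hF).symm.gradedMoritaEquivalent k (hT _) hF)

end LPA

theorem proposition6p6 (k : Type u) [Field k] (E F : LPA.FiniteGraph.{u})
    (hE : E.NoSinks) (hF : F.NoSinks) (h : LPA.StrongShiftEquivalent E.adj F.adj) :
    LPA.CompatibleModuleShiftEquivalent k E F ∧
      LPA.GradedMoritaEquivalent (LPA.Leavitt.grading k E) (LPA.Leavitt.grading k F) := by
  obtain ⟨m, hm⟩ := h.exists_shiftEquivalent k
  exact ⟨.of_shiftEquivalent hm, h.gradedMoritaEquivalent k hE hF⟩
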